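/- Let $X$ be a Cantor space (a compact metrizable space having a countable basis of clopen sets and no isolated points) and let $T:X\to X$ be a minimal homeomorphism. Let $\mathcal P(n)=\{T^{-j}B_k(n):1\le k\le C(n),\ 0\le j<h_k(n)\}$, $n\ge 0$, be a sequence of clopen Kakutani--Rokhlin partitions of $X$, that is, $C(n)\ge 1$ and $h_k(n)\ge 1$ are integers, the sets $B_k(n)$ are non-empty and clopen, and the listed sets $T^{-j}B_k(n)$ are pairwise disjoint with union $X$. Put $B(n)=\bigcup_k B_k(n)$. Suppose that $\mathcal P(0)$ is trivial ($C(0)=1$, $B_1(0)=X$, $h_1(0)=1$) and that - (KR1) $B(n+1)\subseteq B(n)$ for all $n\ge 0$; - (KR2) every element of $\mathcal P(n+1)$ is contained in an element of $\mathcal P(n)$, for all $n\ge0$; - (KR3) $\bigcap_{n\ge 0}B(n)$ consists of a single point; - (KR4) the elements of the partitions $\mathcal P(n)$, $n\ge 0$, form a basis of the topology of $X$; - (KR5) for all $n\ge 1$, $1\le k\le C(n-1)$, $1\le l\le C(n)$ there is $0\le j<h_l(n)$ with $T^{-j}B_l(n)\subseteq B_k(n-1)$; - (KR6) $B(n)\subseteq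 B_1(n-1)$ for all $n\ge 1$; - (LR) there is a constant $L$ such that $h_l(n)\le L\,h_k(n-1)$ for all $n\ge 1$, $1\le l\le C(n)$, $1\le k\le C(n-1)$ (so $(X,T)$ is a linearly recurrent Cantor system). For $n\ge 1$ let $M(n)$ be the $C(n)\times C(n-1)$ matrix with entries $m_{l,k}(n)=\#\{0\le j<h_l(n): T^{-j}B_l(n)\subseteq B_k(n-1)\}$, let $H(1)=(h_1(1),\dots,h_{C(1)}(1))^T=M(1)$, and for $n\ge 2$ let $P(n)=M(n)M(n-1)\cdots M(2)$. For a real vector $V=(v_1,\dots,v_m)^T$ let $|||V|||=\max_{1\le j\le m}|||v_j|||$, where $|||x|||$ is the distance from the real number $x$ to the nearest integer. Let $\alpha\in\mathbb R$ and $\lambda=\exp(2i\pi\alpha)$. 1. Let $\mu$ be the $T$-invariant Borel probability measure on $X$ (it is unique; the claim is made for every such measure). Then $\lambda$ is an eigenvalue of $(X,T)$ with respect to $\mu$, i.e. there is $f\in L^2(X,\mu)$, $f\ne 0$, with $f\circ T=\lambda f$ $\mu$-almost everywhere, if and only if $\sum_{n\ge 2}|||\alpha P(n)H(1)|||^2<\infty$.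 2. $\lambda$ is a continuous eigenvalue of $(X,T)$, i.e. there is a continuous $f:X\to\mathbb C$, $f\neq 0$, with $f\circ T=\lambda f$, if and only if $\sum_{n\ge 2}|||\alpha P(n)H(1)|||<\infty$. -/

import Mathlib

/-- A Cantor space: a (compact metrizable) space whose topology has a countable basis made of
clopen sets, and which has no isolated point. -/
def IsCantorSpace (X : Type*) [TopologicalSpace X] : Prop :=
  (∃ b : Set (Set X), b.Countable ∧ TopologicalSpace.IsTopologicalBasis b ∧ ∀ s ∈ b, IsClopen s) ∧
    ∀ x : X, ¬ IsOpen ({x} : Set X)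

/-- `(X, T)` is minimal: every (two-sided) orbit is dense. -/
def IsMinimalSystem {X : Type*} [TopologicalSpace X] (T : X ≃ₜ X) : Prop :=
  ∀ x : X, Dense (Set.range fun n : ℤ => (T ^ n : X ≃ₜ X) x)

/-- `l` is a continuous eigenvalue of `(X, T)`. -/
def IsContinuousEigenvalue {X : Type*} [TopologicalSpace X] (T : X ≃ₜ X) (l : ℂ) : Prop :=
  ∃ f : X → ℂ, Continuous f ∧ f ≠ 0 ∧ ∀ x, f (T x) = l * f x

/-- `l` is an eigenvalue of `(X, T)` with respect to `μ`: there is an `f ∈ L²(μ)`, nonzero as an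
element of `L²(μ)`, such that `f ∘ T = l f` in `L²(μ)`. -/
def IsMeasurableEigenvalue {X : Type*} [TopologicalSpace X] [MeasurableSpace X] (T : X ≃ₜ X)
    (μ : MeasureTheory.Measure X) (l : ℂ) : Prop :=
  ∃ f : X → ℂ, MeasureTheory.MemLp f 2 μ ∧ ¬ (∀ᵐ x ∂μ, f x = 0) ∧
    ∀ᵐ x ∂μ, f (T x) = l * f x

/-- A clopen Kakutani-Rokhlin partition `{T⁻ʲ B_k ; k < C, 0 ≤ j < h_k}` of `X`
(towers are indexed from `0`). -/
structure CKRPartition {X : Type*} [TopologicalSpace X] (T : X ≃ₜ X) where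
  /-- number of towers -/
  C : ℕ
  /-- roofs of the towers -/
  B : Fin C → Set X
  /-- heights of the towers -/
  h : Fin C → ℕ
  C_pos : 0 < C
  h_pos : ∀ k, 0 < h k
  clopen : ∀ k, IsClopen (B k)
  nonempty : ∀ k, (B k).Nonempty
  /-- the sets `T⁻ʲ B_k` are pairwise disjoint -/
  disjoint : ∀ k k' j j', j < h k → j' < h k' → (k, j) ≠ (k', j') →
    Disjoint (T^[j] ⁻¹' B k) (T^[j'] ⁻¹' B k')
  /-- the sets `T⁻ʲ B_k` cover `X` -/
  cover : ∀ x : X, ∃ k, ∃ j < h k, x ∈ T^[j] ⁻¹' B k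

namespace CKRPartition

variable {X : Type*} [TopologicalSpace X] {T : X ≃ₜ X}

/-- The set of atoms of the partition. -/
def atoms (P : CKRPartition T) : Set (Set X) :=
  {A | ∃ k, ∃ j < P.h k, A = T^[j] ⁻¹' P.B k}

/-- The roof of the partition. -/
def roof (P : CKRPartition T) : Set X := ⋃ k, P.B k

/-- The roof of the first tower. -/
def firstRoof (P : CKRPartition T) : Set X := P.B ⟨0, P.C_pos⟩

/-- A nested sequence `(P(n))_{n ≥ 0}` of CKR partitions, starting at the trivial partition and
satisfying the conditions (KR1)-(KR6). -/
structure IsNestedSeq (P : ℕ → CKRPartition T) : Prop where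
  zero_C : (P 0).C = 1
  zero_B : ∀ k, (P 0).B k = Set.univ
  zero_h : ∀ k, (P 0).h k = 1
  kr1 : ∀ n, (P (n + 1)).roof ⊆ (P n).roof
  kr2 : ∀ n, ∀ A ∈ (P (n + 1)).atoms, ∃ A' ∈ (P n).atoms, A ⊆ A'
  kr3 : ∃ u : X, ⋂ n, (P n).roof = {u}
  kr4 : TopologicalSpace.IsTopologicalBasis (⋃ n, (P n).atoms)
  kr5 : ∀ n, ∀ (k : Fin (P n).C) (l : Fin (P (n + 1)).C), ∃ j < (P (n + 1)).h l,
    T^[j] ⁻¹' (P (n + 1)).B l ⊆ (P n).B k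
  kr6 : ∀ n, (P (n + 1)).roof ⊆ (P n).firstRoof

/-- The condition (LR) of linear recurrence. -/
def IsLinearlyRecurrentSeq (P : ℕ → CKRPartition T) : Prop :=
  ∃ L : ℝ, ∀ n, ∀ (l : Fin (P (n + 1)).C) (k : Fin (P n).C),
    ((P (n + 1)).h l : ℝ) ≤ L * ((P n).h k : ℝ)

open Classical in
/-- `partitionMatrix P n` is the matrix `M(n+1)`, with entries
`m_{l,k}(n+1) = #{0 ≤ j < h_l(n+1) ; T⁻ʲ B_l(n+1) ⊆ B_k(n)}`. -/
noncomputable def partitionMatrix (P : ℕ → CKRPartition T) (n : ℕ) :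
    Matrix (Fin (P (n + 1)).C) (Fin (P n).C) ℝ :=
  fun l k => (((Finset.range ((P (n + 1)).h l)).filter
    (fun j => T^[j] ⁻¹' (P (n + 1)).B l ⊆ (P n).B k)).card : ℝ)

/-- `productMatrix P n` is the matrix `P(n+1) = M(n+1) ⋯ M(2)` (so `P(1)` is the identity). -/
noncomputable def productMatrix (P : ℕ → CKRPartition T) :
    (n : ℕ) → Matrix (Fin (P (n + 1)).C) (Fin (P 1).C) ℝ
  | 0 => 1
  | n + 1 => partitionMatrix P (n + 1) * productMatrix P n

/-- The vector `H(n)` of the heights of the towers of level `n`. -/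
def heightVector (P : ℕ → CKRPartition T) (n : ℕ) : Fin (P n).C → ℝ :=
  fun l => ((P n).h l : ℝ)

/-- As a column vector, `H(1)` is the matrix `M(1)`. -/
theorem heightVector_one (P : ℕ → CKRPartition T) (hP : IsNestedSeq P) (l : Fin (P 1).C)
    (k : Fin (P 0).C) : heightVector P 1 l = partitionMatrix P 0 l k := by
  simp [heightVector, partitionMatrix, hP.zero_B]

end CKRPartition

/-- The distance of a real number to the nearest integer. -/
noncomputable def distInt (x : ℝ) : ℝ := |x - (round x : ℝ)|

/-- `|||V||| = max_j |||v_j|||` (the norm on the right-hand side is the sup norm). -/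
noncomputable def vecDistInt {m : ℕ} (v : Fin m → ℝ) : ℝ := ‖fun j => distInt (v j)‖

/-!
Write `r_n x` for the entrance time of `x` into the roof `B(n)` (`rank`) and `h_k(n)` for the
heights. Counting passages gives `H(n+1) = M(n+1) H(n)`, so the sums in the theorem are those of
`e_n = max_k |||α h_k(n)|||` and of `e_n ^ 2`. Two facts are used throughout. Off the roof,
`r_n (T x) = r_n x - 1`, so `exp (-2 i π α r_n)` satisfies the eigenvalue equation off `B(n)`, and
the `B(n)` shrink to one point. By linear recurrence a tower of level `n+1` consists of at most
`L` towers of level `n`, hence `|||α (r_{n+1} - r_n)||| ≤ L e_n`.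

*Continuous eigenvalues.* If `∑ e_n < ∞`, the functions `exp (-2 i π α r_n)` converge uniformly to
an eigenfunction. Conversely, a continuous eigenfunction does not vanish at the common point of the
`B(n)` and is almost constant on `B(n)` for large `n`, so the differences `d` of return times to
`B(n)` satisfy `|||α d||| ≤ 1/8`. Sums of heights, with one tower chosen at every other level from
`n` on, are such differences (`IsNestedSeq.exists_return_times`). Choosing at each level the tower
that realizes `e_n`, and collecting separately the levels where `α h` lies above resp. below the
nearest integer, one gets sums of small terms of one sign that stay close to integers, hence stay
bounded.

*Measurable eigenvalues, necessity.* For an eigenfunction `f`, the conditional expectation `f_n` of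
`f` with respect to the partition of level `n` is `exp (-2 i π α r_n) c_n(τ_n)`, where `τ_n x` is
the tower of `x` and `c_n(k)` the mean of `f` on `B_k(n)`. By Pythagoras
`∑ ‖f_{n+3} - f_n‖₂ ^ 2 < ∞`. The atoms have measure comparable to `1 / h_k(n)`, and `f_{n+3} - f_n`
has constant modulus along the towers of level `n`, so its `L²` norm controls its values at all
points (`IsNestedSeq.le_mul_integral`). As `f_n` takes a single value on `B(n+1)`, comparing two
consecutive visits of `B(n+1)` inside a tower of level `n+3` bounds `|exp (2 i π α h_k(n+1)) - 1|`
by that norm. If the tower of level `n+3` leaves no room for such visits, level `n+2` has a single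
tower, and then `exp (2 i π α h(n+2)) = 1`.

*Measurable eigenvalues, sufficiency.* Let `S_n` be a real lift of `α r_n` modulo `1` with
`|S_{n+1} - S_n| ≤ L e_n` and `A_n` the averaging along the towers of level `n`. The increments of
`D_n = S_n - A_n S_n` are orthogonal in `L²`, and bounded by `2 L e_n` plus the oscillation of
`A_n S_n`. Each tower of level `n+1` spends a proportion at least `1 / L` of its height in each
tower of level `n`, so averaging contracts oscillations (`IsNestedSeq.towerAverage_sub_le`) and the
oscillation of `A_n S_n` is square summable together with `e_n`. Hence `D_n` converges in `L²` to
some `D`, and `exp (-2 i π D)` is an eigenfunction, because `A_n S_n` is constant along the towers.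
-/

open Filter Topology MeasureTheory

/-! ### Towers of a Kakutani–Rokhlin partition -/

namespace CKRPartition

section Towers

variable {X : Type*} [TopologicalSpace X] {T : X ≃ₜ X}

theorem iterate_symm_iterate (x : X) (i j : ℕ) : T^[i] (T.symm^[i + j] x) = T.symm^[j] x := by
  rw [Function.iterate_add_apply]
  exact (Function.LeftInverse.iterate T.apply_symm_apply i) _

theorem symm_iterate_iterate (x : X) (i j : ℕ) : T.symm^[i] (T^[i + j] x) = T^[j] x := by
  rw [Function.iterate_add_apply]
  exact (Function.LeftInverse.iterate T.symm_apply_apply i) _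

/-- The tower of the partition that contains the point `x`. -/
noncomputable def tower (P : CKRPartition T) (x : X) : Fin P.C := (P.cover x).choose

/-- The number of steps from `x` up to the roof: `x ∈ T⁻ʲ B_k` with `j = P.rank x`,
`k = P.tower x`. It is the entrance time of `x` into the roof. -/
noncomputable def rank (P : CKRPartition T) (x : X) : ℕ := (P.cover x).choose_spec.choose

/-- The point of the roof that lies above `x`. -/
noncomputable def top (P : CKRPartition T) (x : X) : X := T^[P.rank x] x

variable (P : CKRPartition T)

theorem rank_lt (x : X) : P.rank x < P.h (P.tower x) := (P.cover x).choose_spec.choose_spec.1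

theorem top_mem (x : X) : P.top x ∈ P.B (P.tower x) := (P.cover x).choose_spec.choose_spec.2

theorem symm_iterate_top (x : X) : T.symm^[P.rank x] (P.top x) = x :=
  symm_iterate_iterate x (P.rank x) 0

variable {P}

theorem tower_rank_eq {x : X} {k : Fin P.C} {j : ℕ} (hj : j < P.h k) (hx : T^[j] x ∈ P.B k) :
    P.tower x = k ∧ P.rank x = j := by
  by_contra hne
  have := P.disjoint (P.tower x) k (P.rank x) j (P.rank_lt x) hj (by
    intro h; exact hne ⟨congrArg Prod.fst h, congrArg Prod.snd h⟩)
  exact Set.disjoint_left.1 this (P.top_mem x) hx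

theorem tower_symm {x : X} {k : Fin P.C} (hx : x ∈ P.B k) {i : ℕ} (hi : i < P.h k) :
    P.tower (T.symm^[i] x) = k ∧ P.rank (T.symm^[i] x) = i :=
  tower_rank_eq hi (by rwa [show T^[i] (T.symm^[i] x) = x from iterate_symm_iterate x i 0])

theorem top_symm {x : X} {k : Fin P.C} (hx : x ∈ P.B k) {i : ℕ} (hi : i < P.h k) :
    P.top (T.symm^[i] x) = x := by
  rw [top, (tower_symm hx hi).2]
  exact iterate_symm_iterate x i 0

theorem tower_of_mem {x : X} {k : Fin P.C} (hx : x ∈ P.B k) : P.tower x = k ∧ P.rank x = 0 :=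
  tower_symm hx (i := 0) (P.h_pos k)

theorem mem_roof_of_mem {x : X} {k : Fin P.C} (hx : x ∈ P.B k) : x ∈ P.roof :=
  Set.mem_iUnion_of_mem k hx

theorem rank_of_mem_roof {x : X} (hx : x ∈ P.roof) : P.rank x = 0 := by
  obtain ⟨k, hk⟩ := Set.mem_iUnion.1 hx
  exact (tower_of_mem hk).2

theorem top_of_mem_roof {x : X} (hx : x ∈ P.roof) : P.top x = x := by
  rw [top, rank_of_mem_roof hx]; rfl

theorem mem_of_mem_roof {x : X} (hx : x ∈ P.roof) : x ∈ P.B (P.tower x) := by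
  simpa [top_of_mem_roof hx] using P.top_mem x

theorem top_mem_roof (x : X) : P.top x ∈ P.roof := mem_roof_of_mem (P.top_mem x)

theorem tower_rank_iterate {x : X} {i : ℕ} (hi : i ≤ P.rank x) :
    P.tower (T^[i] x) = P.tower x ∧ P.rank (T^[i] x) + i = P.rank x := by
  obtain ⟨j, hj⟩ := Nat.exists_eq_add_of_le' hi
  have h1 : T^[j] (T^[i] x) ∈ P.B (P.tower x) := by
    rw [← Function.iterate_add_apply, ← hj]; exact P.top_mem x
  have h2 := tower_rank_eq (by have := P.rank_lt x; omega) h1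
  exact ⟨h2.1, by omega⟩

theorem rank_pos {x : X} (hx : x ∉ P.roof) : 0 < P.rank x := by
  rcases Nat.eq_zero_or_pos (P.rank x) with h | h
  · have := P.top_mem x
    rw [top, h] at this
    exact absurd (mem_roof_of_mem this) hx
  · exact h

/-- Below the roof, `T` moves a point one step up in its tower. -/
theorem tower_rank_apply {x : X} (hx : x ∉ P.roof) :
    P.tower (T x) = P.tower x ∧ P.rank (T x) + 1 = P.rank x :=
  tower_rank_iterate (i := 1) (rank_pos hx)

theorem top_apply {x : X} (hx : x ∉ P.roof) : P.top (T x) = P.top x := by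
  rw [top, top, ← (tower_rank_apply hx).2, Function.iterate_succ_apply]

/-- Below the lowest floor of a tower there is the roof of some tower. -/
theorem symm_height_mem_roof {x : X} {k : Fin P.C} (hx : x ∈ P.B k) :
    T.symm^[P.h k] x ∈ P.roof := by
  by_contra hn
  obtain ⟨h1, h2⟩ := tower_rank_apply hn
  have hk := P.h_pos k
  obtain ⟨m, hm⟩ := Nat.exists_eq_add_of_lt hk
  have h3 : T (T.symm^[P.h k] x) = T.symm^[P.h k - 1] x := by
    rw [hm, Nat.zero_add, Nat.add_sub_cancel, Nat.add_comm]
    exact iterate_symm_iterate x 1 m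
  rw [h3] at h1 h2
  obtain ⟨h4, h5⟩ := tower_symm hx (i := P.h k - 1) (by omega)
  have := P.rank_lt (T.symm^[P.h k] x)
  rw [← h1, h4, ← h2, h5] at this
  omega

/-- Two consecutive visits to the roof: going down from a point of the roof `B_k`, the roof is not
met again before time `h_k`. -/
theorem add_height_le {x : X} {R j : ℕ} (hR : T.symm^[R] x ∈ P.roof) (hj : j < R) {k : Fin P.C}
    (hk : T.symm^[j] x ∈ P.B k) : j + P.h k ≤ R := by
  by_contra hlt
  obtain ⟨i, hi⟩ := Nat.exists_eq_add_of_le hj.le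
  have h1 := (tower_symm hk (i := i) (by omega)).2
  rw [← Function.iterate_add_apply, show i + j = R by omega, rank_of_mem_roof hR] at h1
  omega

/-- Decomposition of an orbit segment between two points of the roof into full passages through
towers. -/
theorem sum_eq_sum_blocks (R : ℕ) :
    ∀ x : X, x ∈ P.roof → T.symm^[R] x ∈ P.roof →
    ∃ (m : ℕ) (y : ℕ → X), (∀ a < m, y a ∈ P.roof ∧ ∃ j < R, y a = T.symm^[j] x) ∧
      R = ∑ a ∈ Finset.range m, P.h (P.tower (y a)) ∧
      ∀ g : X → ℝ, ∑ i ∈ Finset.range R, g (T.symm^[i] x) =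
        ∑ a ∈ Finset.range m, ∑ i ∈ Finset.range (P.h (P.tower (y a))), g (T.symm^[i] (y a)) := by
  induction R using Nat.strong_induction_on with
  | _ R ih =>
    intro x hx hR
    rcases Nat.eq_zero_or_pos R with rfl | hpos
    · exact ⟨0, fun _ => x, by simp, by simp, by simp⟩
    · have hk := mem_of_mem_roof hx
      have hle := add_height_le hR hpos (j := 0) hk
      set H := P.h (P.tower x) with hH
      have hH0 : 0 < H := P.h_pos _
      obtain ⟨S, hS⟩ := Nat.exists_eq_add_of_le' (show H ≤ R by omega)
      obtain ⟨m, y, h1, h2, h3⟩ := ih S (by omega) (T.symm^[H] x) (symm_height_mem_roof hk)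
        (by rw [← Function.iterate_add_apply, ← hS]; exact hR)
      refine ⟨m + 1, fun a => if a = 0 then x else y (a - 1), ?_, ?_, ?_⟩
      · intro a ha
        rcases a with _ | a
        · exact ⟨by simpa using hx, 0, hpos, rfl⟩
        · obtain ⟨h4, j, hj, h5⟩ := h1 a (by omega)
          refine ⟨by simpa using h4, j + H, by omega, ?_⟩
          simp [h5, Function.iterate_add_apply]
      · rw [Finset.sum_range_succ']
        simp only [Nat.add_eq_zero_iff, one_ne_zero, and_false, if_false, Nat.add_sub_cancel,
          if_true]
        rw [← h2, hS]
      · intro g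
        rw [Finset.sum_range_succ']
        simp only [Nat.add_eq_zero_iff, one_ne_zero, and_false, if_false, Nat.add_sub_cancel,
          if_true]
        rw [← h3 g, hS, Nat.add_comm S H, Finset.sum_range_add, add_comm]
        simp only [← hH, ← Function.iterate_add_apply, Nat.add_comm H]

/-- The function `F` is constant on each atom of the partition. -/
def ConstOnAtoms {Y : Type*} (P : CKRPartition T) (F : X → Y) : Prop :=
  ∀ x y, P.tower x = P.tower y → P.rank x = P.rank y → F x = F y

/-- The function `F` is constant along each passage of an orbit through a tower (and not
necessarily on the whole tower). -/
def ConstAlongTowers {Y : Type*} (P : CKRPartition T) (F : X → Y) : Prop :=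
  ∀ x, x ∉ P.roof → F (T x) = F x

theorem ConstAlongTowers.apply_top {Y : Type*} {F : X → Y} (hF : P.ConstAlongTowers F) (x : X) :
    F (P.top x) = F x := by
  have h : ∀ i ≤ P.rank x, F (T^[i] x) = F x := by
    intro i
    induction i with
    | zero => intro _; rfl
    | succ i ih =>
      intro hi
      have h1 := (tower_rank_iterate (P := P) (x := x) (i := i) (by omega)).2
      rw [Function.iterate_succ_apply', hF, ih (by omega)]
      intro hr
      rw [rank_of_mem_roof hr] at h1
      omega
  exact h _ le_rfl

theorem ConstAlongTowers.symm_iterate {Y : Type*} {F : X → Y} (hF : P.ConstAlongTowers F) {x : X}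
    {k : Fin P.C} (hx : x ∈ P.B k) {i : ℕ} (hi : i < P.h k) : F (T.symm^[i] x) = F x := by
  rw [← hF.apply_top (T.symm^[i] x), top_symm hx hi]

theorem ConstOnAtoms.eq_of_mem_floor {Y : Type*} {F : X → Y} (hF : P.ConstOnAtoms F)
    {k : Fin P.C} {i : ℕ} (hi : i < P.h k) {x y : X} (hx : x ∈ P.B k) (hy : y ∈ T^[i] ⁻¹' P.B k) :
    F y = F (T.symm^[i] x) := by
  obtain ⟨h1, h2⟩ := tower_rank_eq hi hy
  obtain ⟨h3, h4⟩ := tower_symm hx hi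
  exact hF _ _ (h1.trans h3.symm) (h2.trans h4.symm)

theorem ConstOnAtoms.continuous {Y : Type*} [TopologicalSpace Y] {F : X → Y}
    (hF : P.ConstOnAtoms F) : Continuous F := by
  refine IsLocallyConstant.continuous ((IsLocallyConstant.iff_exists_open _).2 fun x => ?_)
  refine ⟨T^[P.rank x] ⁻¹' P.B (P.tower x), ?_, P.top_mem x, fun y hy => ?_⟩
  · exact (P.clopen _).isOpen.preimage (T.continuous.iterate _)
  · obtain ⟨h1, h2⟩ := tower_rank_eq (P.rank_lt x) hy
    exact hF _ _ h1 h2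

end Towers

/-! ### Nested sequences of partitions -/

section Nested

variable {X : Type*} [TopologicalSpace X] {T : X ≃ₜ X} {P : ℕ → CKRPartition T}

theorem IsNestedSeq.roof_subset (hP : IsNestedSeq P) {n m : ℕ} (h : n ≤ m) :
    (P m).roof ⊆ (P n).roof :=
  antitone_nat_of_succ_le (f := fun n => (P n).roof) hP.kr1 h

/-- The partitions are nested: each atom of level `m ≥ n` lies in one atom of level `n`. -/
theorem IsNestedSeq.same_atom (hP : IsNestedSeq P) {n m : ℕ} (h : n ≤ m) {x y : X}
    (ht : (P m).tower x = (P m).tower y) (hr : (P m).rank x = (P m).rank y) :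
    (P n).tower x = (P n).tower y ∧ (P n).rank x = (P n).rank y := by
  induction m, h using Nat.le_induction with
  | base => exact ⟨ht, hr⟩
  | succ m _ ih =>
    obtain ⟨A, ⟨k, j, hj, rfl⟩, hA⟩ := hP.kr2 m _ ⟨_, _, (P (m + 1)).rank_lt x, rfl⟩
    have hx := hA ((P (m + 1)).top_mem x)
    have hy : y ∈ T^[j] ⁻¹' (P m).B k := by
      refine hA ?_
      rw [ht, hr]
      exact (P (m + 1)).top_mem y
    obtain ⟨h1, h2⟩ := tower_rank_eq hj hx
    obtain ⟨h3, h4⟩ := tower_rank_eq hj hy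
    exact ih (h1.trans h3.symm) (h2.trans h4.symm)

theorem IsNestedSeq.constOnAtoms_of_le (hP : IsNestedSeq P) {n m : ℕ} (h : n ≤ m) {Y : Type*}
    {F : X → Y} (hF : (P n).ConstOnAtoms F) : (P m).ConstOnAtoms F := fun x y ht hr =>
  hF x y (hP.same_atom h ht hr).1 (hP.same_atom h ht hr).2

theorem IsNestedSeq.rank_le (hP : IsNestedSeq P) {n m : ℕ} (h : n ≤ m) (x : X) :
    (P n).rank x ≤ (P m).rank x := by
  by_contra hlt
  have h1 := (tower_rank_iterate (P := P n) (x := x) (i := (P m).rank x) (by omega)).2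
  have h2 := rank_of_mem_roof (hP.roof_subset h ((P m).top_mem_roof x))
  rw [top] at h2
  omega

theorem IsNestedSeq.rank_top (hP : IsNestedSeq P) {n m : ℕ} (h : n ≤ m) (x : X) :
    (P m).tower ((P n).top x) = (P m).tower x ∧
      (P m).rank ((P n).top x) + (P n).rank x = (P m).rank x :=
  tower_rank_iterate (hP.rank_le h x)

theorem IsNestedSeq.not_mem_roof (hP : IsNestedSeq P) {n m : ℕ} (h : n ≤ m) {x : X}
    (hx : x ∉ (P n).roof) : x ∉ (P m).roof := fun hm => hx (hP.roof_subset h hm)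

theorem IsNestedSeq.rank_zero (hP : IsNestedSeq P) (x : X) : (P 0).rank x = 0 := by
  have := (P 0).rank_lt x
  rw [hP.zero_h] at this
  omega

theorem IsNestedSeq.constAlongTowers_of_le (hP : IsNestedSeq P) {n m : ℕ} (h : n ≤ m) {Y : Type*}
    {F : X → Y} (hF : (P m).ConstAlongTowers F) : (P n).ConstAlongTowers F := fun x hx =>
  hF x (hP.not_mem_roof h hx)

/-- An atom of level `n+1` that meets `B_k(n)` lies in it. -/
theorem IsNestedSeq.atom_subset_iff (hP : IsNestedSeq P) {n : ℕ} {l : Fin (P (n + 1)).C} {x : X}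
    (hx : x ∈ (P (n + 1)).B l) {j : ℕ} (hj : j < (P (n + 1)).h l) (k : Fin (P n).C) :
    T^[j] ⁻¹' (P (n + 1)).B l ⊆ (P n).B k ↔ T.symm^[j] x ∈ (P n).B k := by
  constructor
  · intro h
    apply h
    rwa [Set.mem_preimage, show T^[j] (T.symm^[j] x) = x from iterate_symm_iterate x j 0]
  · intro h y hy
    obtain ⟨h1, h2⟩ := tower_rank_eq hj hy
    obtain ⟨h3, h4⟩ := tower_symm hx hj
    obtain ⟨h5, h6⟩ := hP.same_atom n.le_succ (h1.trans h3.symm) (h2.trans h4.symm)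
    obtain ⟨h7, h8⟩ := tower_of_mem h
    have := (P n).top_mem y
    rw [h5, h7, top, h6, h8] at this
    exact this

/-- Every tower of level `n+1` passes through every tower of level `n`. -/
theorem IsNestedSeq.exists_block (hP : IsNestedSeq P) {n : ℕ} (l : Fin (P (n + 1)).C)
    (k : Fin (P n).C) : ∃ j, j + (P n).h k ≤ (P (n + 1)).h l ∧
      ∀ x ∈ (P (n + 1)).B l, T.symm^[j] x ∈ (P n).B k := by
  obtain ⟨j, hj, hs⟩ := hP.kr5 n k l
  have h1 : ∀ x ∈ (P (n + 1)).B l, T.symm^[j] x ∈ (P n).B k := fun x hx =>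
    (hP.atom_subset_iff hx hj k).1 hs
  obtain ⟨x, hx⟩ := (P (n + 1)).nonempty l
  exact ⟨j, add_height_le (hP.kr1 n (symm_height_mem_roof hx)) hj (h1 x hx), h1⟩

theorem IsNestedSeq.height_le (hP : IsNestedSeq P) {n : ℕ} (l : Fin (P (n + 1)).C)
    (k : Fin (P n).C) : (P n).h k ≤ (P (n + 1)).h l := by
  obtain ⟨j, hj, -⟩ := hP.exists_block l k
  omega

/-- `H(n+1) = M(n+1) H(n)`. -/
theorem IsNestedSeq.partitionMatrix_mulVec (hP : IsNestedSeq P) (n : ℕ) :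
    (partitionMatrix P n).mulVec (heightVector P n) = heightVector P (n + 1) := by
  classical
  ext l
  obtain ⟨x, hx⟩ := (P (n + 1)).nonempty l
  have hxr : x ∈ (P n).roof := hP.kr1 n (mem_roof_of_mem hx)
  have hxR := hP.kr1 n (symm_height_mem_roof hx)
  -- the weight of a point of the roof is the height of its tower, and the other points weigh `0`
  let g : X → ℝ := fun y => if (P n).rank y = 0 then ((P n).h ((P n).tower y) : ℝ) else 0
  obtain ⟨m, y, h1, h2, h3⟩ := sum_eq_sum_blocks _ x hxr hxR
  replace h3 := h3 g
  have hblock : ∀ a ∈ Finset.range m, ∑ i ∈ Finset.range ((P n).h ((P n).tower (y a))),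
      g (T.symm^[i] (y a)) = ((P n).h ((P n).tower (y a)) : ℝ) := by
    intro a ha
    have hy := mem_of_mem_roof (h1 a (Finset.mem_range.1 ha)).1
    rw [Finset.sum_eq_single 0]
    · simp [g, (tower_of_mem hy).2]
    · intro i hi hi0
      simp [g, (tower_symm hy (Finset.mem_range.1 hi)).2, hi0]
    · intro h
      exact absurd (Finset.mem_range.2 ((P n).h_pos _)) h
  rw [Finset.sum_congr rfl hblock, ← Nat.cast_sum, ← h2] at h3
  simp only [heightVector, ← h3, Matrix.mulVec, dotProduct, partitionMatrix]
  simp only [Finset.card_filter, Nat.cast_sum, Finset.sum_mul]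
  rw [Finset.sum_comm]
  refine Finset.sum_congr rfl fun j hj => ?_
  rw [Finset.mem_range] at hj
  simp only [hP.atom_subset_iff hx hj]
  by_cases hr : (P n).rank (T.symm^[j] x) = 0
  · have hmem : T.symm^[j] x ∈ (P n).B ((P n).tower (T.symm^[j] x)) := by
      have := (P n).top_mem (T.symm^[j] x)
      rwa [top, hr] at this
    rw [Finset.sum_eq_single ((P n).tower (T.symm^[j] x))]
    · simp [g, hr, hmem]
    · intro k _ hk
      rw [if_neg fun h => hk (tower_of_mem h).1.symm]
      simp
    · simp
  · simp only [g, hr, if_false]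
    refine Finset.sum_eq_zero fun k _ => ?_
    rw [if_neg fun h => hr (tower_of_mem h).2]
    simp

theorem IsNestedSeq.productMatrix_mulVec (hP : IsNestedSeq P) (n : ℕ) :
    (productMatrix P n).mulVec (heightVector P 1) = heightVector P (n + 1) := by
  induction n with
  | zero => simp [productMatrix]
  | succ n ih =>
    rw [productMatrix, ← Matrix.mulVec_mulVec, ih, hP.partitionMatrix_mulVec]

end Nested

end CKRPartition

/-! ### Distance to the nearest integer -/

theorem distInt_eq_norm (x : ℝ) : distInt x = ‖(x : UnitAddCircle)‖ := UnitAddCircle.norm_eq.symm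

theorem distInt_nonneg (x : ℝ) : 0 ≤ distInt x := abs_nonneg _

theorem distInt_add_le (x y : ℝ) : distInt (x + y) ≤ distInt x + distInt y := by
  simp only [distInt_eq_norm, AddCircle.coe_add]
  exact norm_add_le _ _

theorem distInt_sum_le {ι : Type*} (s : Finset ι) (f : ι → ℝ) :
    distInt (∑ i ∈ s, f i) ≤ ∑ i ∈ s, distInt (f i) := by
  classical
  induction s using Finset.induction_on with
  | empty => simp [distInt]
  | insert a s ha ih =>
    rw [Finset.sum_insert ha, Finset.sum_insert ha]
    exact (distInt_add_le _ _).trans (by gcongr)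

theorem distInt_sub_int (x : ℝ) (n : ℤ) : distInt (x - n) = distInt x := by
  simp [distInt, round_sub_intCast]

theorem distInt_of_abs_lt {x : ℝ} (hx : |x| < 1 / 2) : distInt x = |x| := by
  have h : round x = 0 := round_eq_zero_iff.2 ⟨by linarith [(abs_lt.1 hx).1], (abs_lt.1 hx).2⟩
  simp [distInt, h]

theorem vecDistInt_nonneg {m : ℕ} (v : Fin m → ℝ) : 0 ≤ vecDistInt v := norm_nonneg _

theorem distInt_le_vecDistInt {m : ℕ} (v : Fin m → ℝ) (k : Fin m) :
    distInt (v k) ≤ vecDistInt v := by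
  have := norm_le_pi_norm (fun j => distInt (v j)) k
  rwa [Real.norm_of_nonneg (distInt_nonneg _)] at this

theorem vecDistInt_le {m : ℕ} {v : Fin m → ℝ} {c : ℝ} (hc : 0 ≤ c) (h : ∀ k, distInt (v k) ≤ c) :
    vecDistInt v ≤ c :=
  (pi_norm_le_iff_of_nonneg hc).2 fun k => by
    rw [Real.norm_of_nonneg (distInt_nonneg _)]; exact h k

theorem exists_vecDistInt_le {m : ℕ} (hm : 0 < m) (v : Fin m → ℝ) :
    ∃ k, vecDistInt v ≤ distInt (v k) := by
  have : Nonempty (Fin m) := ⟨⟨0, hm⟩⟩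
  obtain ⟨k, hk⟩ := Finite.exists_max fun j => distInt (v j)
  exact ⟨k, vecDistInt_le (distInt_nonneg _) hk⟩

/-- The character `t ↦ exp (2 i π t)` of `ℝ`. -/
noncomputable def unitExp (t : ℝ) : ℂ := Complex.exp (2 * Complex.I * Real.pi * t)

theorem unitExp_eq (t : ℝ) : unitExp t = Complex.exp (Complex.I * (2 * Real.pi * t : ℝ)) := by
  rw [unitExp]; congr 1; push_cast; ring

theorem unitExp_zero : unitExp 0 = 1 := by simp [unitExp]

theorem unitExp_add (s t : ℝ) : unitExp (s + t) = unitExp s * unitExp t := by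
  rw [unitExp, unitExp, unitExp, ← Complex.exp_add]; congr 1; push_cast; ring

theorem norm_unitExp (t : ℝ) : ‖unitExp t‖ = 1 := by
  rw [unitExp_eq, mul_comm]
  exact Complex.norm_exp_ofReal_mul_I _

theorem unitExp_ne_zero (t : ℝ) : unitExp t ≠ 0 := Complex.exp_ne_zero _

theorem unitExp_int (n : ℤ) : unitExp n = 1 := by
  rw [unitExp, ← Complex.exp_int_mul_two_pi_mul_I n]; congr 1; push_cast; ring

theorem unitExp_sub_int (t : ℝ) (n : ℤ) : unitExp (t - n) = unitExp t := by
  have := unitExp_add (t - n) n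
  rw [sub_add_cancel, unitExp_int, mul_one] at this
  exact this.symm

theorem continuous_unitExp : Continuous unitExp := by unfold unitExp; fun_prop

theorem norm_unitExp_sub_le (s t : ℝ) : ‖unitExp s - unitExp t‖ ≤ 2 * Real.pi * |s - t| := by
  have h : unitExp s - unitExp t = unitExp t * (unitExp (s - t) - 1) := by
    rw [mul_sub, ← unitExp_add]; simp
  rw [h, norm_mul, norm_unitExp, one_mul, unitExp_eq]
  refine (Real.norm_exp_I_mul_ofReal_sub_one_le).trans ?_
  rw [Real.norm_eq_abs, abs_mul, abs_of_pos Real.two_pi_pos]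

theorem norm_unitExp_sub_one_le (t : ℝ) : ‖unitExp t - 1‖ ≤ 2 * Real.pi * distInt t := by
  have := norm_unitExp_sub_le (t - round t) 0
  rwa [unitExp_sub_int, unitExp_zero, sub_zero] at this

theorem four_mul_distInt_le (t : ℝ) : 4 * distInt t ≤ ‖unitExp t - 1‖ := by
  rw [← unitExp_sub_int t (round t), unitExp_eq, Complex.norm_exp_I_mul_ofReal_sub_one, distInt]
  have h1 := abs_sub_round t
  have h2 : 2 * Real.pi * (t - round t) / 2 = Real.pi * (t - round t) := by ring
  have h3 : |Real.pi * (t - round t)| ≤ Real.pi / 2 := by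
    rw [abs_mul, abs_of_pos Real.pi_pos]
    nlinarith [Real.pi_pos]
  have h4 := Real.mul_abs_le_abs_sin h3
  rw [abs_mul, abs_of_pos Real.pi_pos] at h4
  rw [h2, norm_mul, Real.norm_eq_abs, Real.norm_eq_abs, abs_two]
  have h5 : 2 / Real.pi * (Real.pi * |t - round t|) = 2 * |t - round t| := by
    field_simp
  linarith

/-! ### Linear recurrence -/

namespace CKRPartition

variable {X : Type*} [TopologicalSpace X] {T : X ≃ₜ X} {P : ℕ → CKRPartition T}

/-- `L` is a constant as in the condition (LR) of linear recurrence. -/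
def HeightRatioLE (P : ℕ → CKRPartition T) (L : ℝ) : Prop :=
  ∀ n, ∀ (l : Fin (P (n + 1)).C) (k : Fin (P n).C),
    ((P (n + 1)).h l : ℝ) ≤ L * ((P n).h k : ℝ)

theorem IsNestedSeq.one_le_const (hP : IsNestedSeq P) {L : ℝ}
    (hL : HeightRatioLE P L) : 1 ≤ L := by
  have h1 := hL 0 ⟨0, (P 1).C_pos⟩ ⟨0, (P 0).C_pos⟩
  have h2 := (P 1).h_pos ⟨0, (P 1).C_pos⟩
  rw [hP.zero_h] at h1
  have h3 : (1 : ℝ) ≤ (P 1).h ⟨0, (P 1).C_pos⟩ := by exact_mod_cast h2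
  simpa using h3.trans h1

theorem height_le_pow {L : ℝ} (hL1 : 1 ≤ L)
    (hL : HeightRatioLE P L) (n d : ℕ) (l : Fin (P (n + d + 1)).C)
    (k : Fin (P n).C) : ((P (n + d + 1)).h l : ℝ) ≤ L ^ (d + 1) * ((P n).h k : ℝ) := by
  induction d with
  | zero => simpa using hL n l k
  | succ d ih =>
    have h1 := hL _ l ⟨0, (P (n + d + 1)).C_pos⟩
    have h2 := ih ⟨0, (P (n + d + 1)).C_pos⟩
    calc _ ≤ _ := h1
      _ ≤ L * (L ^ (d + 1) * ((P n).h k : ℝ)) := by gcongr; exact h2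
      _ = _ := by ring

/-- Going from the entrance time into `B(n)` to the one into `B(n+1)` a point passes at most `L`
towers of level `n`. -/
theorem IsNestedSeq.distInt_rank_sub_le (hP : IsNestedSeq P) {L : ℝ}
    (hL : HeightRatioLE P L) (α : ℝ) (n : ℕ) (x : X) :
    distInt (α * ((P (n + 1)).rank x - (P n).rank x)) ≤
      L * vecDistInt (α • heightVector P n) := by
  have h1 := hP.rank_top n.le_succ x
  set y := (P n).top x with hy
  set R := (P (n + 1)).rank y with hR
  have h2 : ((P (n + 1)).rank x - (P n).rank x : ℝ) = R := by
    rw [← h1.2]; push_cast; ring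
  have h3 : T.symm^[R] ((P (n + 1)).top y) = y := symm_iterate_top _ _
  obtain ⟨m, z, hz, hsum, -⟩ := sum_eq_sum_blocks (P := P n) R
    ((P (n + 1)).top y) (hP.kr1 n ((P (n + 1)).top_mem_roof y))
    (by rw [h3]; exact (P n).top_mem_roof x)
  have : Nonempty (Fin (P n).C) := ⟨⟨0, (P n).C_pos⟩⟩
  obtain ⟨k, hk⟩ := Finite.exists_min fun j => (P n).h j
  have h4 : m * (P n).h k ≤ R := by
    rw [hsum]
    simpa using Finset.card_nsmul_le_sum (Finset.range m) _ _ fun a _ => hk ((P n).tower (z a))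
  have h5 : (m : ℝ) ≤ L := by
    have h6 : (R : ℝ) ≤ (P (n + 1)).h ((P (n + 1)).tower y) := by
      exact_mod_cast ((P (n + 1)).rank_lt y).le
    have h7 : ((m : ℝ) * (P n).h k) ≤ R := by exact_mod_cast h4
    have h8 : (0 : ℝ) < (P n).h k := by exact_mod_cast (P n).h_pos k
    exact le_of_mul_le_mul_right (h7.trans (h6.trans (hL n _ k))) h8
  rw [h2, hsum, Nat.cast_sum, Finset.mul_sum]
  calc _ ≤ _ := distInt_sum_le _ _
    _ ≤ ∑ a ∈ Finset.range m, vecDistInt (α • heightVector P n) :=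
      Finset.sum_le_sum fun a _ => distInt_le_vecDistInt (α • heightVector P n) _
    _ = m * vecDistInt (α • heightVector P n) := by simp
    _ ≤ _ := by gcongr; exact vecDistInt_nonneg _

/-- Comparison of consecutive visits of `B(n+1)` inside a tower `B_l(n+3)`: if the function
`i ↦ exp (-2 i π α i) c` is almost constant on the visiting times `i`, then
`exp (2 i π α h_k(n+1))` is close to `1`. The first tower of level `n+2`, with which `l` begins,
contains a passage through the tower `k`. Its start and its end are such times, unless it ends at
the bottom of `l`; then level `n+2` has a single tower, a case treated by `hone`. -/
theorem IsNestedSeq.norm_unitExp_height_sub_one_mul_le (hP : IsNestedSeq P) {α : ℝ} {n : ℕ} {c : ℂ}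
    {q : ℝ} {l : Fin (P (n + 3)).C}
    (hfar : ∃ c' : ℂ, ∀ x ∈ (P (n + 3)).B l, ∀ i < (P (n + 3)).h l,
      T.symm^[i] x ∈ (P (n + 1)).roof → ‖unitExp (-(α * i)) * c - c'‖ ≤ q)
    (hone : (∀ k' : Fin (P (n + 2)).C, k' = ⟨0, (P (n + 2)).C_pos⟩) →
      unitExp (α * (P (n + 2)).h ⟨0, (P (n + 2)).C_pos⟩) = 1) (k : Fin (P (n + 1)).C) :
    ‖unitExp (α * (P (n + 1)).h k) - 1‖ * ‖c‖ ≤ 2 * q := by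
  obtain ⟨c', hc'⟩ := hfar
  obtain ⟨x, hx⟩ := (P (n + 3)).nonempty l
  have hxr := mem_roof_of_mem hx
  have hx0 : x ∈ (P (n + 2)).B ⟨0, (P (n + 2)).C_pos⟩ := hP.kr6 _ hxr
  obtain ⟨j, hj, hjB⟩ := hP.exists_block (n := n + 1) ⟨0, (P (n + 2)).C_pos⟩ k
  replace hj : j + (P (n + 1)).h k ≤ (P (n + 2)).h ⟨0, (P (n + 2)).C_pos⟩ := hj
  have hy := hjB x hx0
  have hz := symm_height_mem_roof hy
  rw [← Function.iterate_add_apply] at hz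
  have hh := (P (n + 1)).h_pos k
  have hle : (P (n + 2)).h ⟨0, (P (n + 2)).C_pos⟩ ≤ (P (n + 3)).h l :=
    hP.height_le (n := n + 2) l ⟨0, (P (n + 2)).C_pos⟩
  have h1 := hc' x hx j (by omega) (mem_roof_of_mem hy)
  have key : ∀ w w' : ℂ, ‖w - c'‖ ≤ q → ‖w' - c'‖ ≤ q → ‖w - w'‖ ≤ 2 * q := by
    intro w w' hw hw'
    rw [← sub_sub_sub_cancel_right w w' c']
    exact (norm_sub_le _ _).trans (by linarith)
  by_cases hlt : (P (n + 1)).h k + j < (P (n + 3)).h l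
  · have h2 := key _ _ h1 (hc' x hx _ hlt hz)
    have h3 : unitExp (-(α * j)) * c - unitExp (-(α * ((P (n + 1)).h k + j : ℕ))) * c =
        unitExp (-(α * ((P (n + 1)).h k + j : ℕ))) *
          ((unitExp (α * (P (n + 1)).h k) - 1) * c) := by
      rw [sub_mul, mul_sub, ← mul_assoc, ← unitExp_add, one_mul]
      push_cast
      ring_nf
    rwa [h3, norm_mul, norm_unitExp, one_mul, norm_mul] at h2
  · -- the towers of level `n+3` consist of a single passage through level `n+2`
    have hC : ∀ k' : Fin (P (n + 2)).C, k' = ⟨0, (P (n + 2)).C_pos⟩ := by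
      intro k'
      obtain ⟨i, hi, hiB⟩ := hP.exists_block (n := n + 2) l k'
      replace hi : i + (P (n + 2)).h k' ≤ (P (n + 3)).h l := hi
      have h4 := (P (n + 2)).h_pos k'
      rw [← (tower_of_mem (hiB x hx)).1]
      exact (tower_symm hx0 (by omega)).1
    have h4 := hone hC
    rw [show (P (n + 2)).h ⟨0, (P (n + 2)).C_pos⟩ = (P (n + 1)).h k + j by omega] at h4
    have h5 : unitExp (-(α * j)) = unitExp (α * (P (n + 1)).h k) := by
      rw [← one_mul (unitExp (-(α * j))), ← h4, ← unitExp_add]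
      push_cast
      ring_nf
    have h6 := hc' x hx 0 ((P (n + 3)).h_pos l) (hP.roof_subset (by omega) hxr)
    rw [h5] at h1
    have h7 := key _ _ h1 h6
    rwa [Nat.cast_zero, mul_zero, neg_zero, unitExp_zero, ← sub_mul, norm_mul] at h7

end CKRPartition

/-! ### Continuous eigenvalues -/

theorem eq_unitExp_mul_symm_iterate {X : Type*} [TopologicalSpace X] {T : X ≃ₜ X} {f : X → ℂ}
    {α : ℝ} (hf : ∀ x, f (T x) = unitExp α * f x) (a : ℕ) (x : X) :
    f x = unitExp (α * a) * f (T.symm^[a] x) := by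
  induction a with
  | zero => simp [unitExp_zero]
  | succ a ih =>
    have h : T (T.symm^[a + 1] x) = T.symm^[a] x := by
      rw [Function.iterate_succ_apply', T.apply_symm_apply]
    rw [ih, ← h, hf, ← mul_assoc, ← unitExp_add]
    push_cast
    ring_nf

/-- If all partial sums are close to integers and the terms are small, the partial sums are
small. -/
theorem abs_sum_le_of_distInt_le {θ : ℕ → ℝ} (h1 : ∀ i, |θ i| ≤ 1 / 8)
    (h2 : ∀ m, distInt (∑ i ∈ Finset.range m, θ i) ≤ 1 / 8) (m : ℕ) :
    |∑ i ∈ Finset.range m, θ i| ≤ 1 / 8 := by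
  induction m with
  | zero => norm_num
  | succ m ih =>
    have h3 : |∑ i ∈ Finset.range (m + 1), θ i| < 1 / 2 := by
      rw [Finset.sum_range_succ]
      linarith [abs_add_le (∑ i ∈ Finset.range m, θ i) (θ m), h1 m]
    rw [← distInt_of_abs_lt h3]
    exact h2 _

theorem abs_sum_ite_le_of_distInt_le {t : ℕ → ℝ} (s : ℕ → Prop) [DecidablePred s]
    (h1 : ∀ i, distInt (t i) ≤ 1 / 8)
    (h2 : ∀ m, distInt (∑ i ∈ Finset.range m, if s i then t i else 0) ≤ 1 / 8) (m : ℕ) :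
    |∑ i ∈ Finset.range m, if s i then t i - round (t i) else 0| ≤ 1 / 8 := by
  refine abs_sum_le_of_distInt_le (fun i => ?_) (fun m => ?_) m
  · split_ifs
    · exact h1 i
    · norm_num
  · have : ∑ i ∈ Finset.range m, (if s i then t i - round (t i) else 0) =
        (∑ i ∈ Finset.range m, if s i then t i else 0) -
          ((∑ i ∈ Finset.range m, if s i then round (t i) else 0 : ℤ) : ℝ) := by
      push_cast
      rw [← Finset.sum_sub_distrib]
      exact Finset.sum_congr rfl fun i _ => by split_ifs <;> simp
    rw [this, distInt_sub_int]
    exact h2 m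

theorem summable_of_summable_even_odd {e : ℕ → ℝ} (h0 : Summable fun i => e (2 * i))
    (h1 : Summable fun i => e (2 * i + 1)) : Summable e :=
  (h0.hasSum.even_add_odd h1.hasSum).summable

namespace CKRPartition

variable {X : Type*} [TopologicalSpace X] {T : X ≃ₜ X} {P : ℕ → CKRPartition T}

theorem isClosed_roof (Q : CKRPartition T) : IsClosed Q.roof :=
  isClosed_iUnion_of_finite fun k => (Q.clopen k).1

/-- Any sum of heights of towers, one tower at most from each of the levels `n₀, n₀+2, …`, is the
difference of two times at which one orbit visits `B(n₀)`. These times do not depend on the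
orbit: by `kr6` a point of `B(n+2)` lies on the roof of the first tower of level `n+1`, and below
it one meets the prescribed tower of level `n` after a fixed time. -/
theorem IsNestedSeq.exists_return_times (hP : IsNestedSeq P) (k : ∀ n, Fin (P n).C) (s : ℕ → Prop)
    [DecidablePred s] (n₀ m : ℕ) :
    ∃ a b : ℕ, a = b + ∑ i ∈ Finset.range m,
        (if s i then (P (n₀ + 2 * i)).h (k (n₀ + 2 * i)) else 0) ∧
      ∀ x ∈ (P (n₀ + 2 * m)).roof, T.symm^[a] x ∈ (P n₀).roof ∧ T.symm^[b] x ∈ (P n₀).roof := by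
  induction m with
  | zero => exact ⟨0, 0, by simp, fun x hx => ⟨hx, hx⟩⟩
  | succ m ih =>
    obtain ⟨a, b, hab, h⟩ := ih
    by_cases hs : s m
    · obtain ⟨j, -, hj⟩ := hP.exists_block ⟨0, (P (n₀ + 2 * m + 1)).C_pos⟩ (k (n₀ + 2 * m))
      refine ⟨a + ((P (n₀ + 2 * m)).h (k (n₀ + 2 * m)) + j), b + j, ?_, fun x hx => ?_⟩
      · rw [Finset.sum_range_succ, if_pos hs, hab]
        ring
      · have h1 := hj x (hP.kr6 _ hx)
        refine ⟨?_, ?_⟩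
        · rw [Function.iterate_add_apply]
          refine (h _ ?_).1
          rw [Function.iterate_add_apply]
          exact symm_height_mem_roof h1
        · rw [Function.iterate_add_apply]
          exact (h _ (mem_roof_of_mem h1)).2
    · refine ⟨a, b, ?_, fun x hx => h x (hP.roof_subset (by omega) hx)⟩
      rw [Finset.sum_range_succ, if_neg hs, hab, add_zero]

theorem IsNestedSeq.exists_roof_subset [CompactSpace X] (hP : IsNestedSeq P) {u : X}
    (hu : ⋂ n, (P n).roof = {u}) {U : Set X} (hU : U ∈ 𝓝 u) : ∃ n, (P n).roof ⊆ U := by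
  refine exists_subset_nhds_of_isCompact' (V := fun n => (P n).roof) ?_ ?_ ?_ ?_
  · exact directed_of_isDirected_le fun n m h => hP.roof_subset h
  · exact fun n => (P n).isClosed_roof.isCompact
  · exact fun n => (P n).isClosed_roof
  · intro x hx
    rw [hu, Set.mem_singleton_iff] at hx
    rwa [hx]

/-- A continuous eigenvalue is almost fixed by the return times to a small roof. -/
theorem IsNestedSeq.exists_forall_return_distInt_le [CompactSpace X] (hP : IsNestedSeq P)
    (hT : IsMinimalSystem T) {α : ℝ} (h : IsContinuousEigenvalue T (unitExp α)) :
    ∃ n₀, ∀ n ≥ n₀, ∀ x : X, ∀ a b d : ℕ, a = b + d → T.symm^[a] x ∈ (P n).roof →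
      T.symm^[b] x ∈ (P n).roof → distInt (α * d) ≤ 1 / 8 := by
  obtain ⟨f, hc, hf0, hf⟩ := h
  obtain ⟨u, hu⟩ := hP.kr3
  have hiter : ∀ (n : ℕ) (x : X), f ((T ^ n : X ≃ₜ X) x) = unitExp α ^ n * f x := by
    intro n
    induction n with
    | zero => intro x; simp
    | succ n ih =>
      intro x
      rw [pow_succ' (unitExp α), mul_assoc, ← ih, ← hf, pow_succ' T]
      rfl
  have hfu : f u ≠ 0 := by
    intro h0
    apply hf0
    refine hc.ext_on (hT u) continuous_const ?_
    rintro _ ⟨n, rfl⟩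
    obtain ⟨m, rfl | rfl⟩ := n.eq_nat_or_neg
    · simp only [zpow_natCast]
      rw [hiter, h0, mul_zero]
      rfl
    · have h1 := hiter m ((T ^ (-(m : ℤ)) : X ≃ₜ X) u)
      have h2 : (T ^ m : X ≃ₜ X) ((T ^ (-(m : ℤ)) : X ≃ₜ X) u) = u := by
        have h3 : T ^ m * T ^ (-(m : ℤ)) = 1 := by simp
        exact congrArg (fun S : X ≃ₜ X => S u) h3
      rw [h2, h0] at h1
      have := mul_eq_zero.1 h1.symm
      simpa [unitExp_ne_zero] using this
  have hpos : 0 < ‖f u‖ := norm_pos_iff.2 hfu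
  obtain ⟨n₀, hn₀⟩ := hP.exists_roof_subset hu
    (hc.continuousAt.preimage_mem_nhds (Metric.closedBall_mem_nhds (f u) (div_pos hpos four_pos)))
  refine ⟨n₀, fun n hn x a b d hd ha hb => ?_⟩
  have h1 := hn₀ (hP.roof_subset hn ha)
  have h2 := hn₀ (hP.roof_subset hn hb)
  simp only [Set.mem_preimage, mem_closedBall_iff_norm] at h1 h2
  have h3 := (eq_unitExp_mul_symm_iterate hf a x).symm.trans (eq_unitExp_mul_symm_iterate hf b x)
  rw [hd, show α * ((b + d : ℕ) : ℝ) = α * b + α * d by push_cast; ring, unitExp_add, mul_assoc,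
    ← hd] at h3
  have h4 := mul_left_cancel₀ (unitExp_ne_zero _) h3
  have h5 : (unitExp (α * d) - 1) * f u = (f (T.symm^[b] x) - f u) -
      unitExp (α * d) * (f (T.symm^[a] x) - f u) := by
    rw [← h4]; ring
  have h6 : ‖unitExp (α * d) - 1‖ * ‖f u‖ ≤ 1 / 2 * ‖f u‖ := by
    rw [← norm_mul, h5]
    refine (norm_sub_le _ _).trans ?_
    rw [norm_mul, norm_unitExp]
    linarith
  linarith [le_of_mul_le_mul_right h6 hpos, four_mul_distInt_le (α * d)]

theorem IsNestedSeq.summable_of_isContinuousEigenvalue [CompactSpace X] (hP : IsNestedSeq P)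
    (hT : IsMinimalSystem T) {α : ℝ} (h : IsContinuousEigenvalue T (unitExp α)) :
    Summable fun n => vecDistInt (α • heightVector P n) := by
  classical
  obtain ⟨n₀, hn₀⟩ := hP.exists_forall_return_distInt_le hT h
  choose k hk using fun n => exists_vecDistInt_le (P n).C_pos (α • heightVector P n)
  have hret : ∀ n ≥ n₀, ∀ (s : ℕ → Prop) [DecidablePred s] (m : ℕ), distInt
      (∑ i ∈ Finset.range m, if s i then α * (P (n + 2 * i)).h (k (n + 2 * i)) else 0) ≤
        1 / 8 := by
    intro n hn s _ m
    obtain ⟨a, b, hab, hx⟩ := hP.exists_return_times k s n m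
    have h1 := (P (n + 2 * m)).nonempty ⟨0, (P (n + 2 * m)).C_pos⟩
    obtain ⟨h2, h3⟩ := hx _ (mem_roof_of_mem h1.some_mem)
    have h4 := hn₀ n hn _ a b _ hab h2 h3
    rw [Nat.cast_sum, Finset.mul_sum] at h4
    convert h4 using 3 with i
    split_ifs <;> simp
  have hone : ∀ n ≥ n₀, distInt (α * (P n).h (k n)) ≤ 1 / 8 := by
    intro n hn
    simpa using hret n hn (fun _ => True) 1
  -- the contributions of the two signs are bounded separately
  have hsum : ∀ n ≥ n₀, Summable fun i => vecDistInt (α • heightVector P (n + 2 * i)) := by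
    intro n hn
    refine summable_of_sum_range_le (c := 1 / 4) (fun i => vecDistInt_nonneg _) fun m => ?_
    set t : ℕ → ℝ := fun i => α * (P (n + 2 * i)).h (k (n + 2 * i)) with ht
    have h1 := abs_sum_ite_le_of_distInt_le (t := t) (fun i => 0 ≤ t i - round (t i))
      (fun i => hone _ (by omega)) (hret n hn _) m
    have h2 := abs_sum_ite_le_of_distInt_le (t := t) (fun i => ¬ 0 ≤ t i - round (t i))
      (fun i => hone _ (by omega)) (hret n hn _) m
    calc _ ≤ ∑ i ∈ Finset.range m, |t i - round (t i)| := Finset.sum_le_sum fun i _ => hk _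
      _ = (∑ i ∈ Finset.range m, if 0 ≤ t i - round (t i) then t i - round (t i) else 0) -
          ∑ i ∈ Finset.range m, if ¬ 0 ≤ t i - round (t i) then t i - round (t i) else 0 := by
        rw [← Finset.sum_sub_distrib]
        refine Finset.sum_congr rfl fun i _ => ?_
        by_cases h0 : 0 ≤ t i - round (t i)
        · simp [h0, abs_of_nonneg h0]
        · simp [h0, abs_of_neg (not_le.1 h0)]
      _ ≤ 1 / 4 := by linarith [abs_le.1 h1, abs_le.1 h2]
  rw [← summable_nat_add_iff n₀]
  refine summable_of_summable_even_odd ?_ ?_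
  · refine (hsum n₀ le_rfl).congr fun i => ?_
    rw [add_comm]
  · have := hsum (n₀ + 1) (by omega)
    refine this.congr fun i => ?_
    rw [show n₀ + 1 + 2 * i = 2 * i + 1 + n₀ by ring]

/-- The locally constant approximations `exp (- 2 i π α r_n)` of an eigenfunction. -/
noncomputable def approxEigenfunction (α : ℝ) (Q : CKRPartition T) (x : X) : ℂ :=
  unitExp (-(α * Q.rank x))

theorem approxEigenfunction_apply (α : ℝ) {Q : CKRPartition T} {x : X} (hx : x ∉ Q.roof) :
    approxEigenfunction α Q (T x) = unitExp α * approxEigenfunction α Q x := by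
  rw [approxEigenfunction, approxEigenfunction, ← unitExp_add, ← (tower_rank_apply hx).2]
  push_cast
  ring_nf

theorem continuous_approxEigenfunction (α : ℝ) (Q : CKRPartition T) :
    Continuous (approxEigenfunction α Q) :=
  ConstOnAtoms.continuous (P := Q) fun x y _ h => by
    rw [approxEigenfunction, approxEigenfunction, h]

theorem IsNestedSeq.norm_approxEigenfunction_sub_le (hP : IsNestedSeq P) {L : ℝ}
    (hL : HeightRatioLE P L) (α : ℝ) (n : ℕ) (x : X) :
    ‖approxEigenfunction α (P (n + 1)) x - approxEigenfunction α (P n) x‖ ≤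
      2 * Real.pi * (L * vecDistInt (α • heightVector P n)) := by
  have h1 : approxEigenfunction α (P (n + 1)) x - approxEigenfunction α (P n) x =
      -approxEigenfunction α (P (n + 1)) x *
        (unitExp (α * ((P (n + 1)).rank x - (P n).rank x)) - 1) := by
    rw [mul_sub, neg_mul, approxEigenfunction, approxEigenfunction, ← unitExp_add]
    ring_nf
  rw [h1, norm_mul, norm_neg, approxEigenfunction, norm_unitExp, one_mul]
  refine (norm_unitExp_sub_one_le _).trans ?_
  have := hP.distInt_rank_sub_le hL α n x
  gcongr

theorem IsNestedSeq.isContinuousEigenvalue_of_summable (hP : IsNestedSeq P)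
    (hLR : IsLinearlyRecurrentSeq P) [T2Space X] (hX : ∀ x : X, ¬ IsOpen ({x} : Set X)) {α : ℝ}
    (h : Summable fun n => vecDistInt (α • heightVector P n)) :
    IsContinuousEigenvalue T (unitExp α) := by
  obtain ⟨L, hL⟩ := hLR
  obtain ⟨u, hu⟩ := hP.kr3
  set g : ℕ → X → ℂ := fun n => approxEigenfunction α (P n) with hg
  have hgc : ∀ n, Continuous (g n) := fun n => continuous_approxEigenfunction α (P n)
  have hle := hP.norm_approxEigenfunction_sub_le hL α
  have hsum : Summable fun n => 2 * Real.pi * (L * vecDistInt (α • heightVector P n)) :=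
    (h.mul_left L).mul_left _
  set F : X → ℂ := fun x => g 0 x + ∑' n, (g (n + 1) x - g n x) with hF
  have hFc : Continuous F :=
    (hgc 0).add (continuous_tsum (fun n => (hgc (n + 1)).sub (hgc n)) hsum hle)
  have hlim : ∀ x, Tendsto (fun n => g n x) atTop (𝓝 (F x)) := by
    intro x
    have h1 := (Summable.of_norm_bounded hsum fun n => hle n x).hasSum.tendsto_sum_nat.const_add
      (g 0 x)
    refine h1.congr fun n => ?_
    rw [Finset.sum_range_sub (fun n => g n x)]
    ring
  refine ⟨F, hFc, ?_, fun x => ?_⟩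
  · intro h0
    have h1 := (hlim u).norm
    simp only [h0, Pi.zero_apply, norm_zero, hg, approxEigenfunction, norm_unitExp] at h1
    exact one_ne_zero (tendsto_nhds_unique tendsto_const_nhds h1)
  · have hdense : Dense ({u}ᶜ : Set X) := dense_compl_singleton_iff_not_open.2 (hX u)
    have := (hFc.comp T.continuous).ext_on hdense (continuous_const.mul hFc)
      (g := fun x => unitExp α * F x) ?_
    · exact congrFun this x
    -- a point other than `u` lies off `B(m)` for all large `m`
    · intro x hx
      have h1 : ∃ n, x ∉ (P n).roof := by
        by_contra! hall
        have : x ∈ ⋂ n, (P n).roof := Set.mem_iInter.2 hall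
        rw [hu] at this
        exact hx this
      obtain ⟨n, hn⟩ := h1
      refine tendsto_nhds_unique (hlim (T x)) (((hlim x).const_mul (unitExp α)).congr' ?_)
      filter_upwards [eventually_ge_atTop n] with m hm
      exact (approxEigenfunction_apply α (hP.not_mem_roof hm hn)).symm

end CKRPartition

/-! ### Invariant measures of the atoms -/

namespace CKRPartition

variable {X : Type*} [TopologicalSpace X] [MeasurableSpace X] [BorelSpace X] {T : X ≃ₜ X}
  {P : ℕ → CKRPartition T} {Q : CKRPartition T} {μ : Measure X}

theorem measurableEmbedding_iterate (T : X ≃ₜ X) (i : ℕ) : MeasurableEmbedding T^[i] := by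
  induction i with
  | zero => exact MeasurableEmbedding.id
  | succ i ih => exact ih.comp T.measurableEmbedding

theorem measurableSet_base (k : Fin Q.C) : MeasurableSet (Q.B k) := (Q.clopen k).2.measurableSet

theorem measurableSet_floor (k : Fin Q.C) (i : ℕ) : MeasurableSet (T^[i] ⁻¹' Q.B k) :=
  (measurableEmbedding_iterate T i).measurable (measurableSet_base k)

theorem measureReal_floor (hμ : MeasurePreserving T μ μ) (k : Fin Q.C) (i : ℕ) :
    μ.real (T^[i] ⁻¹' Q.B k) = μ.real (Q.B k) :=
  (hμ.iterate i).measureReal_preimage (measurableSet_base k).nullMeasurableSet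

theorem ConstOnAtoms.integrable [CompactSpace X] [IsProbabilityMeasure μ] {E : Type*}
    [NormedAddCommGroup E] {F : X → E} (hF : Q.ConstOnAtoms F) :
    Integrable F μ :=
  hF.continuous.integrable_of_hasCompactSupport (HasCompactSupport.of_compactSpace F)

theorem ConstOnAtoms.integrable_mul [CompactSpace X] [IsProbabilityMeasure μ] {𝕜 : Type*}
    [RCLike 𝕜] {F g : X → 𝕜} (hF : Integrable F μ) (hg : Q.ConstOnAtoms g) :
    Integrable (fun x => F x * g x) μ := by
  obtain ⟨C, hC⟩ := isCompact_univ.exists_bound_of_continuousOn hg.continuous.continuousOn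
  exact hF.mul_bdd (hg.integrable (μ := μ)).aestronglyMeasurable
    (Eventually.of_forall fun x => hC x (Set.mem_univ x))

theorem integral_eq_sum_floors {E : Type*} [NormedAddCommGroup E] [NormedSpace ℝ E] {F : X → E}
    (hF : Integrable F μ) :
    ∫ x, F x ∂μ = ∑ k, ∑ i ∈ Finset.range (Q.h k), ∫ x in T^[i] ⁻¹' Q.B k, F x ∂μ := by
  have hcov : (Set.univ : Set X) =
      ⋃ p ∈ Finset.univ.sigma (fun k => Finset.range (Q.h k)), T^[p.2] ⁻¹' Q.B p.1 := by
    symm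
    rw [Set.eq_univ_iff_forall]
    intro x
    obtain ⟨k, j, hj, hx⟩ := Q.cover x
    exact Set.mem_iUnion₂.2 ⟨⟨k, j⟩, by simpa using hj, hx⟩
  rw [← setIntegral_univ, hcov, integral_biUnion_finset, Finset.sum_sigma]
  · exact fun p _ => measurableSet_floor _ _
  · rintro ⟨k, i⟩ hp ⟨k', i'⟩ hp' hne
    simp only [Finset.coe_sigma, Set.mem_sigma_iff, Finset.coe_univ, Set.mem_univ, true_and,
      Finset.coe_range, Set.mem_Iio] at hp hp'
    refine Q.disjoint k k' i i' hp hp' ?_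
    intro h
    apply hne
    obtain ⟨rfl, rfl⟩ := Prod.mk.inj h
    rfl
  · exact fun p _ => hF.integrableOn

theorem setIntegral_floor_of_constOnAtoms {E : Type*} [NormedAddCommGroup E] [NormedSpace ℝ E]
    [CompleteSpace E] (hμ : MeasurePreserving T μ μ) {F : X → E} (hF : Q.ConstOnAtoms F)
    {k : Fin Q.C} {i : ℕ} (hi : i < Q.h k) {x : X} (hx : x ∈ Q.B k) :
    ∫ y in T^[i] ⁻¹' Q.B k, F y ∂μ = μ.real (Q.B k) • F (T.symm^[i] x) := by
  rw [setIntegral_congr_fun (measurableSet_floor k i) fun y hy => hF.eq_of_mem_floor hi hx hy,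
    setIntegral_const, measureReal_floor hμ]

/-- A nonnegative function which is constant on the atoms of level `m` and along the towers of
level `n ≤ m` takes each of its values on a whole column of height `h_k(n)`. -/
theorem IsNestedSeq.mul_le_integral [CompactSpace X] [IsProbabilityMeasure μ]
    (hP : IsNestedSeq P) (hμ : MeasurePreserving T μ μ) {n m : ℕ} (h : n ≤ m) {G : X → ℝ}
    (hG : ∀ x, 0 ≤ G x) (hm : (P m).ConstOnAtoms G) (hn : (P n).ConstAlongTowers G) (x : X) :
    μ.real ((P m).B ((P m).tower x)) * (P n).h ((P n).tower x) * G x ≤ ∫ x, G x ∂μ := by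
  rw [integral_eq_sum_floors (Q := P m) hm.integrable]
  refine le_trans ?_ (Finset.single_le_sum (f := fun k => ∑ i ∈ Finset.range ((P m).h k),
    ∫ x in T^[i] ⁻¹' (P m).B k, G x ∂μ) (fun k _ => Finset.sum_nonneg fun i _ =>
      integral_nonneg fun x => hG x) (Finset.mem_univ ((P m).tower x)))
  have htop := (P m).top_mem x
  rw [Finset.sum_congr rfl fun i hi =>
    setIntegral_floor_of_constOnAtoms hμ hm (Finset.mem_range.1 hi) htop]
  set j := (P m).rank ((P n).top x) with hj
  have hle := (hP.rank_top h x).1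
  have htt : (P m).top ((P n).top x) = (P m).top x := by
    change T^[(P m).rank ((P n).top x)] (T^[(P n).rank x] x) = T^[(P m).rank x] x
    rw [← Function.iterate_add_apply, (hP.rank_top h x).2]
  have hj2 : T.symm^[j] ((P m).top x) = (P n).top x := by
    rw [← htt, hj, symm_iterate_top]
  have hblock : j + (P n).h ((P n).tower x) ≤ (P m).h ((P m).tower x) :=
    add_height_le (hP.roof_subset h (symm_height_mem_roof htop))
      (by rw [hj, ← hle]; exact (P m).rank_lt _) (by rw [hj2]; exact (P n).top_mem x)
  calc _ = ∑ i ∈ Finset.range ((P n).h ((P n).tower x)),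
        μ.real ((P m).B ((P m).tower x)) • G (T.symm^[i + j] ((P m).top x)) := by
        rw [Finset.sum_congr rfl fun i hi => by
          rw [Function.iterate_add_apply, hj2,
            hn.symm_iterate ((P n).top_mem x) (Finset.mem_range.1 hi), hn.apply_top]]
        simp only [smul_eq_mul, Finset.sum_const, Finset.card_range, nsmul_eq_mul]
        ring
    _ = ∑ i ∈ (Finset.range ((P n).h ((P n).tower x))).map (addRightEmbedding j),
        μ.real ((P m).B ((P m).tower x)) • G (T.symm^[i] ((P m).top x)) := by
        rw [Finset.sum_map]; rfl
    _ ≤ _ := by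
        refine Finset.sum_le_sum_of_subset_of_nonneg ?_ fun i _ _ =>
          smul_nonneg measureReal_nonneg (hG _)
        intro i hi
        obtain ⟨i', hi', rfl⟩ := Finset.mem_map.1 hi
        rw [Finset.mem_range] at hi' ⊢
        simp only [addRightEmbedding_apply]
        omega

/-- By linear recurrence, every tower has measure at least `1 / L`: the towers of level `n+1` have
total measure `1` and heights at most `L h_k(n)`, and each of them has a floor in `B_k(n)`. -/
theorem IsNestedSeq.one_le_mul_measure [CompactSpace X] [IsProbabilityMeasure μ]
    (hP : IsNestedSeq P) (hμ : MeasurePreserving T μ μ) {L : ℝ}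
    (hL : HeightRatioLE P L) (n : ℕ) (k : Fin (P n).C) :
    1 ≤ L * (P n).h k * μ.real ((P n).B k) := by
  choose j hj hjs using fun l => hP.kr5 n k l
  have h1 : ∑ l, μ.real ((P (n + 1)).B l) ≤ μ.real ((P n).B k) := by
    rw [← Finset.sum_congr rfl fun l _ => measureReal_floor (Q := P (n + 1)) hμ l (j l),
      ← measureReal_iUnion_fintype]
    · exact measureReal_mono (Set.iUnion_subset hjs)
    · intro l l' hne
      exact (P (n + 1)).disjoint l l' _ _ (hj l) (hj l') fun h => hne (Prod.mk.inj h).1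
    · exact fun l => measurableSet_floor _ _
  have h2 := integral_eq_sum_floors (Q := P (n + 1)) (integrable_const (μ := μ) (1 : ℝ))
  simp only [smul_eq_mul, mul_one, integral_const, probReal_univ,
    measureReal_restrict_apply_univ, measureReal_floor hμ, Finset.sum_const,
    Finset.card_range, nsmul_eq_mul] at h2
  rw [h2]
  have hL1 := hP.one_le_const hL
  calc _ ≤ ∑ l, L * (P n).h k * μ.real ((P (n + 1)).B l) :=
        Finset.sum_le_sum fun l _ => mul_le_mul_of_nonneg_right (hL n l k) measureReal_nonneg
    _ = L * (P n).h k * ∑ l, μ.real ((P (n + 1)).B l) := by rw [Finset.mul_sum]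
    _ ≤ _ := by gcongr

/-- A nonnegative function which is constant on the atoms of level `m = n+d+1` and along the towers
of level `n` is controlled everywhere by its integral. -/
theorem IsNestedSeq.le_mul_integral [CompactSpace X] [IsProbabilityMeasure μ]
    (hP : IsNestedSeq P) (hμ : MeasurePreserving T μ μ) {L : ℝ}
    (hL : HeightRatioLE P L) (n d : ℕ) {G : X → ℝ}
    (hG : ∀ x, 0 ≤ G x) (hm : (P (n + d + 1)).ConstOnAtoms G) (hn : (P n).ConstAlongTowers G)
    (x : X) : G x ≤ L ^ (d + 2) * ∫ x, G x ∂μ := by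
  have hL1 := hP.one_le_const hL
  have h1 := hP.mul_le_integral hμ (show n ≤ n + d + 1 by omega) hG hm hn x
  have h2 := hP.one_le_mul_measure hμ hL (n + d + 1) ((P (n + d + 1)).tower x)
  have h3 := height_le_pow hL1 hL n d ((P (n + d + 1)).tower x) ((P n).tower x)
  calc G x = 1 * G x := (one_mul _).symm
    _ ≤ (L * (L ^ (d + 1) * (P n).h ((P n).tower x)) *
        μ.real ((P (n + d + 1)).B ((P (n + d + 1)).tower x))) * G x := by
      refine mul_le_mul_of_nonneg_right (h2.trans ?_) (hG x)
      gcongr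
    _ = L ^ (d + 2) * (μ.real ((P (n + d + 1)).B ((P (n + d + 1)).tower x)) *
        (P n).h ((P n).tower x) * G x) := by ring
    _ ≤ _ := by gcongr

end CKRPartition

/-! ### Measurable eigenvalues: necessity -/

theorem ae_apply_iterate {X : Type*} [TopologicalSpace X] [MeasurableSpace X] {T : X ≃ₜ X}
    {μ : Measure X} (hμ : MeasurePreserving T μ μ) {f : X → ℂ} {α : ℝ}
    (hf : ∀ᵐ x ∂μ, f (T x) = unitExp α * f x) (i : ℕ) :
    ∀ᵐ x ∂μ, f x = unitExp (-(α * i)) * f (T^[i] x) := by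
  induction i with
  | zero => simp [unitExp_zero]
  | succ i ih =>
    filter_upwards [ih, (hμ.iterate i).quasiMeasurePreserving.ae hf] with x h1 h2
    rw [Function.iterate_succ_apply', h2, h1, ← mul_assoc, ← unitExp_add]
    push_cast
    ring_nf

namespace CKRPartition

/-- For an eigenfunction `f` with eigenvalue `exp (2 i π α)`, this is the conditional expectation
of `f` with respect to the partition `Q`: on the base `B_k` it is the mean `c_k` of `f`, and
`exp (- 2 i π α j) c_k` on `T⁻ʲ B_k`. -/
noncomputable def eigenMean {X : Type*} [TopologicalSpace X] [MeasurableSpace X] {T : X ≃ₜ X}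
    (Q : CKRPartition T) (μ : Measure X) (α : ℝ) (f : X → ℂ) (x : X) : ℂ :=
  unitExp (-(α * Q.rank x)) *
    ((∫ y in Q.B (Q.tower x), f y ∂μ) / μ.real (Q.B (Q.tower x)))

variable {X : Type*} [TopologicalSpace X] [MeasurableSpace X] {T : X ≃ₜ X}
  {P : ℕ → CKRPartition T} {Q : CKRPartition T} {μ : Measure X} {α : ℝ} {f : X → ℂ}

theorem constOnAtoms_eigenMean (Q : CKRPartition T) (μ : Measure X) (α : ℝ) (f : X → ℂ) :
    Q.ConstOnAtoms (Q.eigenMean μ α f) := fun x y ht hr => by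
  rw [eigenMean, eigenMean, ht, hr]

theorem constOnAtoms_normSq_eigenMean (Q : CKRPartition T) (μ : Measure X) (α : ℝ) (f : X → ℂ) :
    Q.ConstOnAtoms fun x => Complex.normSq (Q.eigenMean μ α f x) := fun x y ht hr => by
  simp only [constOnAtoms_eigenMean Q μ α f x y ht hr]

theorem eigenMean_symm_iterate {k : Fin Q.C} {x : X} (hx : x ∈ Q.B k) {i : ℕ} (hi : i < Q.h k) :
    Q.eigenMean μ α f (T.symm^[i] x) =
      unitExp (-(α * i)) * ((∫ y in Q.B k, f y ∂μ) / μ.real (Q.B k)) := by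
  rw [eigenMean, (tower_symm hx hi).1, (tower_symm hx hi).2]

theorem eigenMean_apply {x : X} (hx : x ∉ Q.roof) :
    Q.eigenMean μ α f (T x) = unitExp α * Q.eigenMean μ α f x := by
  rw [eigenMean, eigenMean, (tower_rank_apply hx).1, ← mul_assoc, ← unitExp_add,
    ← (tower_rank_apply hx).2]
  push_cast
  ring_nf

variable [BorelSpace X]

theorem setIntegral_floor (hμ : MeasurePreserving T μ μ)
    (hf : ∀ᵐ x ∂μ, f (T x) = unitExp α * f x) (k : Fin Q.C) (i : ℕ) :
    ∫ x in T^[i] ⁻¹' Q.B k, f x ∂μ = unitExp (-(α * i)) * ∫ x in Q.B k, f x ∂μ := by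
  rw [← (hμ.iterate i).setIntegral_preimage_emb (measurableEmbedding_iterate T i) f (Q.B k),
    ← integral_const_mul]
  exact integral_congr_ae (ae_restrict_of_ae (ae_apply_iterate hμ hf i))

/-- If there is only one tower, the base is invariant under `T ^ h`. -/
theorem unitExp_height_mul_setIntegral (hμ : MeasurePreserving T μ μ)
    (hf : ∀ᵐ x ∂μ, f (T x) = unitExp α * f x) (k : Fin Q.C) (hk : ∀ k', k' = k) :
    unitExp (α * Q.h k) * ∫ x in Q.B k, f x ∂μ = ∫ x in Q.B k, f x ∂μ := by
  have hroof : Q.roof ⊆ Q.B k := Set.iUnion_subset fun k' => by rw [hk k']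
  have h1 : T^[Q.h k] ⁻¹' Q.B k = Q.B k := by
    ext x
    constructor
    · intro hx
      have := symm_height_mem_roof hx
      rw [show T.symm^[Q.h k] (T^[Q.h k] x) = x from symm_iterate_iterate x (Q.h k) 0] at this
      exact hroof this
    · intro hx
      -- the point `T x` lies on the lowest floor
      have h2 : Q.rank (T x) + 1 = Q.h k := by
        have h3 := hk (Q.tower (T x))
        have h4 := Q.rank_lt (T x)
        rw [h3] at h4
        by_contra hne
        have h5 := Q.top_mem (T x)
        rw [h3, top, ← Function.iterate_succ_apply] at h5
        have h6 := (tower_rank_eq (by omega) h5).2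
        rw [(tower_of_mem hx).2] at h6
        omega
      have h3 := Q.top_mem (T x)
      rw [hk (Q.tower (T x)), top, ← Function.iterate_succ_apply, Nat.succ_eq_add_one, h2] at h3
      exact h3
  have h2 := setIntegral_floor hμ hf k (Q.h k)
  rw [h1] at h2
  conv_lhs => rw [h2]
  rw [← mul_assoc, ← unitExp_add, add_neg_cancel, unitExp_zero, one_mul]

theorem base_measure_pos [CompactSpace X] [IsProbabilityMeasure μ]
    (hP : IsNestedSeq P) (hLR : IsLinearlyRecurrentSeq P) (hμ : MeasurePreserving T μ μ) (n : ℕ)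
    (k : Fin (P n).C) : 0 < μ.real ((P n).B k) := by
  obtain ⟨L, hL⟩ := hLR
  have h1 := hP.one_le_mul_measure hμ hL n k
  refine lt_of_le_of_ne measureReal_nonneg fun h0 => ?_
  rw [← h0] at h1
  norm_num at h1

variable [CompactSpace X] [IsProbabilityMeasure μ]

/-- `f - Q.eigenMean μ α f` is orthogonal to the functions that are constant on the atoms. -/
theorem integral_mul_eq_integral_eigenMean_mul (hμ : MeasurePreserving T μ μ)
    (hf : ∀ᵐ x ∂μ, f (T x) = unitExp α * f x) (hint : Integrable f μ)
    (hQ : ∀ k, 0 < μ.real (Q.B k)) {g : X → ℂ} (hg : Q.ConstOnAtoms g) :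
    ∫ x, f x * g x ∂μ = ∫ x, Q.eigenMean μ α f x * g x ∂μ := by
  have hm := constOnAtoms_eigenMean Q μ α f
  rw [integral_eq_sum_floors (Q := Q) (hg.integrable_mul hint),
    integral_eq_sum_floors (Q := Q) (hg.integrable_mul hm.integrable)]
  refine Finset.sum_congr rfl fun k _ => Finset.sum_congr rfl fun i hi => ?_
  rw [Finset.mem_range] at hi
  obtain ⟨x, hx⟩ := Q.nonempty k
  have hmg : Q.ConstOnAtoms fun x => Q.eigenMean μ α f x * g x := fun x y ht hr => by
    simp only [hm x y ht hr, hg x y ht hr]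
  rw [setIntegral_floor_of_constOnAtoms hμ hmg hi hx, eigenMean_symm_iterate hx hi,
    setIntegral_congr_fun (measurableSet_floor k i)
      (g := fun y => f y * g (T.symm^[i] x)) fun y hy => by
        simp only [hg.eq_of_mem_floor hi hx hy],
    integral_mul_const, setIntegral_floor hμ hf, Complex.real_smul]
  have : (μ.real (Q.B k) : ℂ) ≠ 0 := by exact_mod_cast (hQ k).ne'
  field_simp

/-- Pythagoras, for a function `F` that has the same conditional expectation as `f`. -/
theorem integral_normSq_sub (hμ : MeasurePreserving T μ μ)
    (hf : ∀ᵐ x ∂μ, f (T x) = unitExp α * f x) (hint : Integrable f μ)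
    (hQ : ∀ k, 0 < μ.real (Q.B k)) {F : X → ℂ} (hF : Integrable F μ)
    (hF2 : Integrable (fun x => Complex.normSq (F x)) μ)
    (hFQ : ∀ g : X → ℂ, Q.ConstOnAtoms g → ∫ x, F x * g x ∂μ = ∫ x, f x * g x ∂μ) :
    ∫ x, Complex.normSq (F x - Q.eigenMean μ α f x) ∂μ =
      ∫ x, Complex.normSq (F x) ∂μ - ∫ x, Complex.normSq (Q.eigenMean μ α f x) ∂μ := by
  have hm := constOnAtoms_eigenMean Q μ α f
  have hmc : Q.ConstOnAtoms fun x => (starRingEnd ℂ) (Q.eigenMean μ α f x) := fun x y ht hr => by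
    simp only [hm x y ht hr]
  have hms : Q.ConstOnAtoms fun x => Complex.normSq (Q.eigenMean μ α f x) := fun x y ht hr => by
    simp only [hm x y ht hr]
  have hmul := hmc.integrable_mul hF
  have h1 : ∫ x, (F x * (starRingEnd ℂ) (Q.eigenMean μ α f x)).re ∂μ =
      ∫ x, Complex.normSq (Q.eigenMean μ α f x) ∂μ := by
    have h2 := hFQ _ hmc
    rw [integral_mul_eq_integral_eigenMean_mul hμ hf hint hQ hmc] at h2
    simp only [Complex.mul_conj] at h2
    have h3 := integral_re (𝕜 := ℂ) hmul
    have h4 := congrArg Complex.re h2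
    rw [integral_complex_ofReal, Complex.ofReal_re] at h4
    rw [← h4]
    exact h3
  simp only [Complex.normSq_sub]
  rw [integral_sub, integral_add hF2 hms.integrable, integral_const_mul, h1]
  · ring
  · exact hF2.add hms.integrable
  · exact hmul.re.const_mul 2

/-- Pythagoras for the conditional expectations on two levels. -/
theorem IsNestedSeq.integral_normSq_eigenMean_sub (hP : IsNestedSeq P)
    (hLR : IsLinearlyRecurrentSeq P) (hμ : MeasurePreserving T μ μ)
    (hf : ∀ᵐ x ∂μ, f (T x) = unitExp α * f x) (hint : Integrable f μ) {n m : ℕ} (h : n ≤ m) :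
    ∫ x, Complex.normSq ((P m).eigenMean μ α f x - (P n).eigenMean μ α f x) ∂μ =
      ∫ x, Complex.normSq ((P m).eigenMean μ α f x) ∂μ -
        ∫ x, Complex.normSq ((P n).eigenMean μ α f x) ∂μ :=
  integral_normSq_sub hμ hf hint (base_measure_pos hP hLR hμ n)
    (constOnAtoms_eigenMean (P m) μ α f).integrable
    (constOnAtoms_normSq_eigenMean (P m) μ α f).integrable fun _ hg =>
      (integral_mul_eq_integral_eigenMean_mul hμ hf hint (base_measure_pos hP hLR hμ m)
        (hP.constOnAtoms_of_le h hg)).symm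

theorem IsNestedSeq.integral_normSq_eigenMean_mono (hP : IsNestedSeq P)
    (hLR : IsLinearlyRecurrentSeq P) (hμ : MeasurePreserving T μ μ)
    (hf : ∀ᵐ x ∂μ, f (T x) = unitExp α * f x) (hint : Integrable f μ) :
    Monotone fun n => ∫ x, Complex.normSq ((P n).eigenMean μ α f x) ∂μ := fun n m h => by
  have h1 := hP.integral_normSq_eigenMean_sub hLR hμ hf hint h
  have h2 := integral_nonneg (μ := μ) (f := fun x =>
    Complex.normSq ((P m).eigenMean μ α f x - (P n).eigenMean μ α f x))
    fun x => Complex.normSq_nonneg _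
  simp only
  linarith

theorem IsNestedSeq.integral_normSq_eigenMean_le (hP : IsNestedSeq P)
    (hLR : IsLinearlyRecurrentSeq P) (hμ : MeasurePreserving T μ μ)
    (hf : ∀ᵐ x ∂μ, f (T x) = unitExp α * f x) (hint : Integrable f μ)
    (hf2 : Integrable (fun x => Complex.normSq (f x)) μ) (n : ℕ) :
    ∫ x, Complex.normSq ((P n).eigenMean μ α f x) ∂μ ≤ ∫ x, Complex.normSq (f x) ∂μ := by
  have h1 := integral_normSq_sub hμ hf hint (base_measure_pos hP hLR hμ n) hint hf2 fun _ _ => rfl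
  have h2 := integral_nonneg (μ := μ) (f := fun x =>
    Complex.normSq (f x - (P n).eigenMean μ α f x)) fun x => Complex.normSq_nonneg _
  linarith

/-- The conditional expectations do not all vanish, since the atoms of all levels generate the
Borel sets. -/
theorem IsNestedSeq.exists_integral_normSq_eigenMean_pos [TopologicalSpace.MetrizableSpace X]
    (hP : IsNestedSeq P) (hLR : IsLinearlyRecurrentSeq P) (hμ : MeasurePreserving T μ μ)
    (hf : ∀ᵐ x ∂μ, f (T x) = unitExp α * f x) (hint : Integrable f μ)
    (hf0 : ¬ ∀ᵐ x ∂μ, f x = 0) :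
    ∃ n, 0 < ∫ x, Complex.normSq ((P n).eigenMean μ α f x) ∂μ := by
  by_contra! hall
  apply hf0
  have hbase : ∀ n (k : Fin (P n).C), ∫ x in (P n).B k, f x ∂μ = 0 := by
    intro n k
    obtain ⟨x, hx⟩ := (P n).nonempty k
    have h1 := hP.mul_le_integral hμ (le_refl n)
      (G := fun x => Complex.normSq ((P n).eigenMean μ α f x))
      (fun x => Complex.normSq_nonneg _) (constOnAtoms_normSq_eigenMean (P n) μ α f)
      (fun x hx => by
        simp only [eigenMean_apply hx, map_mul, Complex.normSq_eq_norm_sq (unitExp α),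
          norm_unitExp, one_pow, one_mul]) x
    have h2 := base_measure_pos hP hLR hμ n ((P n).tower x)
    have h3 : (0 : ℝ) < (P n).h ((P n).tower x) := by exact_mod_cast (P n).h_pos _
    have h4 : Complex.normSq ((P n).eigenMean μ α f x) ≤ 0 := by
      by_contra! h5
      have := mul_pos (mul_pos h2 h3) h5
      linarith [hall n]
    have h5 := Complex.normSq_eq_zero.1 (le_antisymm h4 (Complex.normSq_nonneg _))
    have h6 := eigenMean_symm_iterate (μ := μ) (α := α) (f := f) hx (i := 0) ((P n).h_pos k)
    rw [Function.iterate_zero, id, h5] at h6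
    have h7 : (μ.real ((P n).B k) : ℂ) ≠ 0 := by
      exact_mod_cast (base_measure_pos hP hLR hμ n k).ne'
    simpa [unitExp_ne_zero, h7] using h6.symm
  refine hint.ae_eq_zero_of_forall_setIntegral_eq_zero fun s hs _ => ?_
  have hgen : ‹MeasurableSpace X› = MeasurableSpace.generateFrom (⋃ n, (P n).atoms) :=
    BorelSpace.measurable_eq.trans hP.kr4.borel_eq_generateFrom
  have hpi : IsPiSystem (⋃ n, (P n).atoms) := by
    have key : ∀ n m, n ≤ m → ∀ A ∈ (P n).atoms, ∀ A' ∈ (P m).atoms, (A ∩ A').Nonempty →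
        A ∩ A' = A' := by
      rintro n m hnm _ ⟨k, j, hj, rfl⟩ _ ⟨k', j', hj', rfl⟩ ⟨x, hx, hx'⟩
      refine Set.inter_eq_right.2 fun y hy => ?_
      obtain ⟨h1, h2⟩ := tower_rank_eq hj hx
      obtain ⟨h3, h4⟩ := tower_rank_eq hj' hx'
      obtain ⟨h5, h6⟩ := tower_rank_eq hj' hy
      obtain ⟨h7, h8⟩ := hP.same_atom hnm (h5.trans h3.symm) (h6.trans h4.symm)
      have := (P n).top_mem y
      rwa [top, h7, h8, h1, h2] at this
    intro A hA A' hA' hne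
    obtain ⟨n, hn⟩ := Set.mem_iUnion.1 hA
    obtain ⟨m, hm⟩ := Set.mem_iUnion.1 hA'
    rcases le_total n m with h | h
    · rw [key n m h A hn A' hm hne]; exact hA'
    · rw [Set.inter_comm, key m n h A' hm A hn (by rwa [Set.inter_comm])]; exact hA
  induction s, hs using MeasurableSpace.induction_on_inter hgen hpi with
  | empty => simp
  | basic A hA =>
    obtain ⟨n, k, j, hj, rfl⟩ := Set.mem_iUnion.1 hA
    rw [setIntegral_floor hμ hf, hbase, mul_zero]
  | compl A hA ih =>
    have h1 : ∫ x, f x ∂μ = 0 := by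
      rw [integral_eq_sum_floors (Q := P 0) hint]
      exact Finset.sum_eq_zero fun k _ => Finset.sum_eq_zero fun i _ => by
        rw [setIntegral_floor hμ hf, hbase, mul_zero]
    rw [setIntegral_compl hA hint, h1, ih (measure_lt_top μ A), sub_zero]
  | iUnion A hd hA ih =>
    rw [integral_iUnion hA hd hint.integrableOn]
    simp [ih, measure_lt_top]

theorem IsNestedSeq.summable_of_isMeasurableEigenvalue [TopologicalSpace.MetrizableSpace X]
    (hP : IsNestedSeq P) (hLR : IsLinearlyRecurrentSeq P) (hμ : MeasurePreserving T μ μ)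
    (h : IsMeasurableEigenvalue T μ (unitExp α)) :
    Summable fun n => vecDistInt (α • heightVector P n) ^ 2 := by
  obtain ⟨f, hf2, hf0, hf⟩ := h
  have hint : Integrable f μ := hf2.integrable one_le_two
  have hsq : Integrable (fun x => Complex.normSq (f x)) μ := by
    simp only [Complex.normSq_eq_norm_sq]
    exact hf2.integrable_norm_pow two_ne_zero
  obtain ⟨n₀, hn₀⟩ := hP.exists_integral_normSq_eigenMean_pos hLR hμ hf hint hf0
  have hmono := hP.integral_normSq_eigenMean_mono hLR hμ hf hint
  have hbdd := hP.integral_normSq_eigenMean_le hLR hμ hf hint hsq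
  have hpyth : ∀ n, _ := fun n =>
    hP.integral_normSq_eigenMean_sub hLR hμ hf hint (show n ≤ n + 3 by omega)
  have hQpos := base_measure_pos hP hLR hμ
  obtain ⟨L, hL⟩ := hLR
  set t : ℕ → ℝ := fun n => ∫ x, Complex.normSq ((P n).eigenMean μ α f x) ∂μ with ht
  have hL1 := hP.one_le_const hL
  -- the variation of the conditional expectations is small at every point
  have hptw : ∀ n x, ‖(P (n + 3)).eigenMean μ α f x - (P n).eigenMean μ α f x‖ ≤
      √(L ^ 4 * (t (n + 3) - t n)) := by
    intro n x
    refine Real.le_sqrt_of_sq_le ?_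
    rw [← Complex.normSq_eq_norm_sq, ht]
    simp only
    rw [← hpyth n]
    refine hP.le_mul_integral hμ hL n 2 (G := fun x =>
      Complex.normSq ((P (n + 3)).eigenMean μ α f x - (P n).eigenMean μ α f x))
      (fun x => Complex.normSq_nonneg _) (fun x y h1 h2 => ?_) (fun x hx => ?_) x
    · simp only [constOnAtoms_eigenMean (P (n + 3)) μ α f x y h1 h2,
        hP.constOnAtoms_of_le (show n ≤ n + 3 by omega)
          (constOnAtoms_eigenMean (P n) μ α f) x y h1 h2]
    · simp only [eigenMean_apply hx, eigenMean_apply (hP.not_mem_roof (show n ≤ n + 3 by omega) hx)]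
      rw [← mul_sub, map_mul, Complex.normSq_eq_norm_sq (unitExp α), norm_unitExp, one_pow,
        one_mul]
  have hmain : ∀ n ≥ n₀, ∀ k : Fin (P (n + 1)).C,
      ‖unitExp (α * (P (n + 1)).h k) - 1‖ * √(t n₀) ≤ 2 * √(L ^ 4 * (t (n + 3) - t n)) := by
    intro n hn k
    obtain ⟨x, hx⟩ := exists_integral_le
      (constOnAtoms_normSq_eigenMean (P (n + 3)) μ α f).integrable (μ := μ)
    set l := (P (n + 3)).tower x
    set c := (∫ y in (P (n + 3)).B l, f y ∂μ) / μ.real ((P (n + 3)).B l) with hc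
    have hcx : √(t n₀) ≤ ‖c‖ := by
      refine Real.sqrt_le_iff.2 ⟨norm_nonneg _, ?_⟩
      refine (hmono (show n₀ ≤ n + 3 by omega)).trans (hx.trans ?_)
      rw [eigenMean, map_mul, Complex.normSq_eq_norm_sq (unitExp _), norm_unitExp, one_pow,
        one_mul, Complex.normSq_eq_norm_sq]
    refine (mul_le_mul_of_nonneg_left hcx (norm_nonneg _)).trans ?_
    refine hP.norm_unitExp_height_sub_one_mul_le (l := l) ⟨(∫ y in (P n).B ⟨0, (P n).C_pos⟩,
      f y ∂μ) / μ.real ((P n).B ⟨0, (P n).C_pos⟩), fun y hy i hi hr => ?_⟩ (fun hC => ?_) k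
    · have h1 := hptw n (T.symm^[i] y)
      rw [eigenMean_symm_iterate hy hi] at h1
      have h2 := eigenMean_symm_iterate (μ := μ) (α := α) (f := f) (hP.kr6 n hr) (i := 0)
        ((P n).h_pos _)
      rw [Function.iterate_zero, id, Nat.cast_zero, mul_zero, neg_zero, unitExp_zero,
        one_mul] at h2
      rwa [h2] at h1
    · have h1 := unitExp_height_mul_setIntegral hμ hf _ hC
      refine mul_right_cancel₀ ?_ (h1.trans (one_mul _).symm)
      intro h0
      have h2 : t (n + 2) = 0 := by
        rw [ht]
        simp only [eigenMean, hC, h0, zero_div, mul_zero, map_zero, integral_zero]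
      have := hmono (show n₀ ≤ n + 2 by omega)
      simp only [h2] at this
      linarith
  rw [← summable_nat_add_iff (n₀ + 1)]
  -- `t` is monotone and bounded
  have htel : Summable fun n => t (n + n₀ + 3) - t (n + n₀) := by
    refine summable_of_sum_range_le (c := 3 * ∫ x, Complex.normSq (f x) ∂μ)
      (fun n => sub_nonneg.2 (hmono (by omega))) fun m => ?_
    have h1 : ∀ m, ∑ n ∈ Finset.range m, (t (n + n₀ + 3) - t (n + n₀)) =
        (t (m + n₀) + t (m + n₀ + 1) + t (m + n₀ + 2)) - (t n₀ + t (n₀ + 1) + t (n₀ + 2)) := by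
      intro m
      induction m with
      | zero => simp
      | succ m ih =>
        rw [Finset.sum_range_succ, ih, show m + 1 + n₀ = m + n₀ + 1 by ring]
        ring
    have h0 : ∀ n, 0 ≤ t n := fun n => integral_nonneg fun x => Complex.normSq_nonneg _
    rw [h1]
    linarith [hbdd (m + n₀), hbdd (m + n₀ + 1), hbdd (m + n₀ + 2), h0 n₀, h0 (n₀ + 1),
      h0 (n₀ + 2)]
  refine Summable.of_nonneg_of_le (fun n => sq_nonneg _) (fun n => ?_)
    (htel.mul_left (L ^ 4 / (4 * t n₀)))
  obtain ⟨k, hk⟩ := exists_vecDistInt_le (P (n + n₀ + 1)).C_pos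
    (α • heightVector P (n + n₀ + 1))
  have h1 := hmain (n + n₀) (by omega) k
  have h2 := four_mul_distInt_le (α * (P (n + n₀ + 1)).h k)
  have h3 : vecDistInt (α • heightVector P (n + n₀ + 1)) * (2 * √(t n₀)) ≤
      √(L ^ 4 * (t (n + n₀ + 3) - t (n + n₀))) := by
    have h4 : vecDistInt (α • heightVector P (n + n₀ + 1)) ≤
      distInt (α * (P (n + n₀ + 1)).h k) := hk
    have h5 : 4 * vecDistInt (α • heightVector P (n + n₀ + 1)) * √(t n₀) ≤
        ‖unitExp (α * (P (n + n₀ + 1)).h k) - 1‖ * √(t n₀) := by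
      gcongr
      linarith
    linarith
  have h4 := pow_le_pow_left₀ (mul_nonneg (vecDistInt_nonneg _) (by positivity)) h3 2
  have h5 : 0 ≤ t (n + n₀ + 3) - t (n + n₀) := sub_nonneg.2 (hmono (by omega))
  rw [Real.sq_sqrt (by positivity), mul_pow, mul_pow, Real.sq_sqrt hn₀.le] at h4
  rw [show n + (n₀ + 1) = n + n₀ + 1 by ring, div_mul_eq_mul_div, le_div_iff₀ (by positivity)]
  linarith

end CKRPartition

/-! ### Convergence lemmas -/

/-- A sequence `ω` with `ω (n+1) ≤ ρ ω n + b n`, `ρ < 1`, is square summable if `b` is. -/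
theorem summable_sq_of_contraction {ω b : ℕ → ℝ} {ρ : ℝ} (h0 : 0 ≤ ρ) (h1 : ρ < 1)
    (h : ∀ n, ω (n + 1) = ρ * ω n + b n)
    (hb : Summable fun n => b n ^ 2) : Summable fun n => ω n ^ 2 := by
  have hρ : 0 < 1 - ρ := by linarith
  -- convexity of the square
  have hstep : ∀ n, ω (n + 1) ^ 2 ≤ ρ * ω n ^ 2 + b n ^ 2 / (1 - ρ) := by
    intro n
    have h2 : ρ * ω n ^ 2 + b n ^ 2 / (1 - ρ) - ω (n + 1) ^ 2 =
        ρ / (1 - ρ) * ((1 - ρ) * ω n - b n) ^ 2 := by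
      rw [h]; field_simp; ring
    have h3 : 0 ≤ ρ / (1 - ρ) * ((1 - ρ) * ω n - b n) ^ 2 := by positivity
    linarith
  refine summable_of_sum_range_le
    (c := (ω 0 ^ 2 + (∑' n, b n ^ 2) / (1 - ρ)) / (1 - ρ)) (fun n => sq_nonneg _) fun m => ?_
  rw [le_div_iff₀ hρ]
  have h2 : ∑ n ∈ Finset.range (m + 1), ω n ^ 2 ≤
      ρ * ∑ n ∈ Finset.range m, ω n ^ 2 + (∑ n ∈ Finset.range m, b n ^ 2) / (1 - ρ) + ω 0 ^ 2 := by
    rw [Finset.sum_range_succ', Finset.mul_sum, Finset.sum_div, ← Finset.sum_add_distrib]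
    gcongr with n
    exact hstep n
  have h3 : (∑ n ∈ Finset.range m, b n ^ 2) / (1 - ρ) ≤ (∑' n, b n ^ 2) / (1 - ρ) := by
    gcongr
    exact hb.sum_le_tsum _ fun n _ => sq_nonneg _
  rw [Finset.sum_range_succ] at h2
  nlinarith [sq_nonneg (ω m)]

/-- A Cauchy sequence in `L²` has a subsequence that converges almost everywhere. -/
theorem exists_ae_tendsto_of_cauchy_integral_sq {X : Type*} [MeasurableSpace X] {μ : Measure X}
    {f : ℕ → X → ℝ} (hf : ∀ n, MemLp (f n) 2 μ)
    (hC : ∀ ε > 0, ∃ N, ∀ m ≥ N, ∫ x, (f m x - f N x) ^ 2 ∂μ < ε) :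
    ∃ g : X → ℝ, AEStronglyMeasurable g μ ∧ ∃ φ : ℕ → ℕ, StrictMono φ ∧
      ∀ᵐ x ∂μ, Tendsto (fun n => f (φ n) x) atTop (𝓝 (g x)) := by
  have hdist : ∀ m n, dist ((hf m).toLp (f m)) ((hf n).toLp (f n)) ^ 2 =
      ∫ x, (f m x - f n x) ^ 2 ∂μ := by
    intro m n
    rw [dist_eq_norm, ← MemLp.toLp_sub, ← real_inner_self_eq_norm_sq, L2.inner_def]
    refine integral_congr_ae ?_
    filter_upwards [((hf m).sub (hf n)).coeFn_toLp] with x hx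
    rw [hx]
    simp [sq]
  have hcau : CauchySeq fun n => (hf n).toLp (f n) := by
    refine Metric.cauchySeq_iff'.2 fun ε hε => ?_
    obtain ⟨N, hN⟩ := hC (ε ^ 2) (by positivity)
    refine ⟨N, fun m hm => lt_of_pow_lt_pow_left₀ 2 hε.le ?_⟩
    rw [hdist]
    exact hN m hm
  obtain ⟨G, hG⟩ := cauchySeq_tendsto_of_complete hcau
  obtain ⟨φ, hφ, hlim⟩ := (tendstoInMeasure_of_tendsto_Lp hG).exists_seq_tendsto_ae
  refine ⟨G, Lp.aestronglyMeasurable G, φ, hφ, ?_⟩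
  filter_upwards [hlim, ae_all_iff.2 fun n => (hf n).coeFn_toLp] with x hx hall
  exact hx.congr fun n => hall _

/-! ### Invariant measures have no atoms -/

/-- In a minimal Cantor system invariant measures have no atoms. -/
theorem measure_singleton_eq_zero {X : Type*} [TopologicalSpace X] [T1Space X]
    [MeasurableSpace X] [BorelSpace X] {T : X ≃ₜ X} (hT : IsMinimalSystem T)
    (hX : ∀ x : X, ¬ IsOpen ({x} : Set X)) {μ : Measure X} [IsFiniteMeasure μ]
    (hμ : MeasurePreserving T μ μ) (u : X) : μ {u} = 0 := by
  by_contra hu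
  obtain ⟨x, hx, m, hm, hxm⟩ := hμ.exists_mem_iterate_mem
    (measurableSet_singleton u).nullMeasurableSet hu
  rw [Set.mem_singleton_iff] at hx hxm
  rw [hx] at hxm
  have hpow : ∀ n : ℕ, ((T ^ n : X ≃ₜ X) : X → X) = T^[n] := by
    intro n
    induction n with
    | zero => rfl
    | succ n ih =>
      rw [Function.iterate_succ', ← ih, pow_succ' T]
      rfl
  -- the point `u` is periodic, hence has a finite orbit
  let S : Subgroup (X ≃ₜ X) :=
    { carrier := {g | g u = u}
      mul_mem' := fun {a b} ha hb => show a (b u) = u by rw [hb, ha]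
      one_mem' := rfl
      inv_mem' := fun {a} ha => show a.symm u = u by
        rw [Homeomorph.symm_apply_eq]; exact Eq.symm ha }
  have hmS : T ^ m ∈ S := show (T ^ m : X ≃ₜ X) u = u by rw [hpow]; exact hxm
  have hfin : (Set.range fun n : ℤ => (T ^ n : X ≃ₜ X) u).Finite := by
    refine ((Finset.range m).finite_toSet.image fun i => T^[i] u).subset ?_
    rintro _ ⟨n, rfl⟩
    have hm0 : (m : ℤ) ≠ 0 := by exact_mod_cast hm
    refine ⟨(n % m).toNat, ?_, ?_⟩
    · have := Int.emod_lt_of_pos n (show (0 : ℤ) < m by omega)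
      have := Int.emod_nonneg n hm0
      simp only [Finset.coe_range, Set.mem_Iio]
      omega
    · have h1 : T ^ n = T ^ (n % m).toNat * (T ^ m) ^ (n / m) := by
        rw [← zpow_natCast, ← zpow_natCast, ← zpow_mul, ← zpow_add,
          Int.toNat_of_nonneg (Int.emod_nonneg n hm0), Int.emod_add_mul_ediv]
      have h2 : ((T ^ m) ^ (n / m) : X ≃ₜ X) u = u := S.zpow_mem hmS _
      simp only [h1]
      change _ = (T ^ (n % m).toNat : X ≃ₜ X) (((T ^ m) ^ (n / m) : X ≃ₜ X) u)
      rw [h2, hpow]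
  have huniv : (Set.univ : Set X).Finite := by
    rw [← (hT u).closure_eq, hfin.isClosed.closure_eq]
    exact hfin
  have := Set.finite_univ_iff.1 huniv
  exact hX u (isOpen_discrete _)

namespace CKRPartition

/-! ### Averages along towers -/

section Average

variable {X : Type*} [TopologicalSpace X] {T : X ≃ₜ X} {P : ℕ → CKRPartition T}
  {Q : CKRPartition T}

/-- The mean of `g` over the passage of the orbit of `x` through its tower: a pointwise version of
the conditional expectation of `g` given the functions that are constant along the towers. -/
noncomputable def towerAverage (Q : CKRPartition T) (g : X → ℝ) (x : X) : ℝ :=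
  (∑ i ∈ Finset.range (Q.h (Q.tower x)), g (T.symm^[i] (Q.top x))) / Q.h (Q.tower x)

theorem height_pos (k : Fin Q.C) : (0 : ℝ) < Q.h k := by exact_mod_cast Q.h_pos k

theorem constAlongTowers_towerAverage (Q : CKRPartition T) (g : X → ℝ) :
    Q.ConstAlongTowers (Q.towerAverage g) := fun x hx => by
  rw [towerAverage, towerAverage, top_apply hx, (tower_rank_apply hx).1]

theorem ConstOnAtoms.towerAverage_eq {g : X → ℝ} (hg : Q.ConstOnAtoms g) {x y : X}
    (h : Q.tower x = Q.tower y) : Q.towerAverage g x = Q.towerAverage g y := by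
  rw [towerAverage, towerAverage, h]
  congr 1
  refine Finset.sum_congr rfl fun i hi => ?_
  rw [Finset.mem_range] at hi
  obtain ⟨h1, h2⟩ := tower_symm (Q.top_mem y) hi
  obtain ⟨h3, h4⟩ := tower_symm (Q.top_mem x) (h ▸ hi)
  exact hg _ _ (by rw [h1, h3, h]) (by rw [h2, h4])

theorem towerAverage_le {g : X → ℝ} {M : ℝ} (hg : ∀ x, g x ≤ M) (x : X) :
    Q.towerAverage g x ≤ M := by
  rw [towerAverage, div_le_iff₀ (height_pos _)]
  refine (Finset.sum_le_sum fun i _ => hg _).trans ?_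
  simp [mul_comm]

theorem le_towerAverage {g : X → ℝ} {M : ℝ} (hg : ∀ x, M ≤ g x) (x : X) :
    M ≤ Q.towerAverage g x := by
  rw [towerAverage, le_div_iff₀ (height_pos _)]
  refine le_trans ?_ (Finset.sum_le_sum fun i _ => hg _)
  simp [mul_comm]

theorem towerAverage_add (g g' : X → ℝ) (x : X) :
    Q.towerAverage (fun y => g y + g' y) x = Q.towerAverage g x + Q.towerAverage g' x := by
  rw [towerAverage, towerAverage, towerAverage, Finset.sum_add_distrib, add_div]

theorem sum_towerAverage {g : X → ℝ} {x : X} {k : Fin Q.C} (hx : x ∈ Q.B k) :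
    ∑ i ∈ Finset.range (Q.h k), Q.towerAverage g (T.symm^[i] x) =
      ∑ i ∈ Finset.range (Q.h k), g (T.symm^[i] x) := by
  have h1 : ∀ i ∈ Finset.range (Q.h k), Q.towerAverage g (T.symm^[i] x) =
      (∑ i ∈ Finset.range (Q.h k), g (T.symm^[i] x)) / Q.h k := by
    intro i hi
    rw [Finset.mem_range] at hi
    rw [towerAverage, top_symm hx hi, (tower_symm hx hi).1]
  rw [Finset.sum_congr rfl h1, Finset.sum_const, Finset.card_range, nsmul_eq_mul,
    mul_div_cancel₀ _ (height_pos k).ne']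

/-- A tower of level `n+1` is cut into towers of level `n`, so that averaging first over the
latter changes nothing. -/
theorem IsNestedSeq.towerAverage_towerAverage (hP : IsNestedSeq P) (n : ℕ) (g : X → ℝ) (x : X) :
    (P (n + 1)).towerAverage ((P n).towerAverage g) x = (P (n + 1)).towerAverage g x := by
  rw [towerAverage, towerAverage]
  congr 1
  have htop := (P (n + 1)).top_mem x
  obtain ⟨m, y, h1, -, h3⟩ := sum_eq_sum_blocks (P := P n) _ _
    (hP.kr1 n (mem_roof_of_mem htop)) (hP.kr1 n (symm_height_mem_roof htop))
  rw [h3, h3]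
  exact Finset.sum_congr rfl fun a ha =>
    sum_towerAverage (mem_of_mem_roof (h1 a (Finset.mem_range.1 ha)).1)

/-- Doeblin's argument: each tower of level `n+1` spends at least the proportion `1 / L` of its
height in any given tower of level `n`, so averaging contracts oscillations by `1 - 1 / L`. -/
theorem IsNestedSeq.towerAverage_sub_le (hP : IsNestedSeq P) {L : ℝ}
    (hL : HeightRatioLE P L) {n : ℕ} {g : X → ℝ} {ω : ℝ}
    (hg : ∀ x y, (P n).tower x = (P n).tower y → g x = g y) (hω : ∀ x y, g x - g y ≤ ω) (x y : X) :
    (P (n + 1)).towerAverage g x - (P (n + 1)).towerAverage g y ≤ (1 - 1 / L) * ω := by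
  have hL0 : 0 < L := zero_lt_one.trans_le (hP.one_le_const hL)
  have hω0 : 0 ≤ ω := by simpa using hω x x
  have : Nonempty (Fin (P n).C) := ⟨⟨0, (P n).C_pos⟩⟩
  choose p hp using (P n).nonempty
  obtain ⟨k, hk⟩ := Finite.exists_min fun k => g (p k)
  have hmin : ∀ z, g (p k) ≤ g z := fun z => by
    rw [hg z (p ((P n).tower z)) (tower_of_mem (hp _)).1.symm]
    exact hk _
  have hlow := le_towerAverage (Q := P (n + 1)) hmin y
  set l := (P (n + 1)).tower x with hl
  obtain ⟨j, hj, hjB⟩ := hP.exists_block l k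
  have htop := (P (n + 1)).top_mem x
  have hy := hjB _ htop
  have hsum : (P n).h k * ω ≤ ∑ i ∈ Finset.range ((P (n + 1)).h l),
      (g (p k) + ω - g (T.symm^[i] ((P (n + 1)).top x))) := by
    calc ((P n).h k : ℝ) * ω = ∑ i ∈ Finset.range ((P n).h k),
          (g (p k) + ω - g (T.symm^[i + j] ((P (n + 1)).top x))) := by
          rw [Finset.sum_congr rfl fun i hi => by
            rw [Function.iterate_add_apply, hg _ (p k)
              (((tower_symm hy (Finset.mem_range.1 hi)).1).trans (tower_of_mem (hp k)).1.symm)]]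
          simp
      _ = ∑ i ∈ (Finset.range ((P n).h k)).map (addRightEmbedding j),
          (g (p k) + ω - g (T.symm^[i] ((P (n + 1)).top x))) := by
          rw [Finset.sum_map]; rfl
      _ ≤ _ := by
          refine Finset.sum_le_sum_of_subset_of_nonneg ?_ fun i _ _ => ?_
          · intro i hi
            obtain ⟨i', hi', rfl⟩ := Finset.mem_map.1 hi
            rw [Finset.mem_range] at hi' ⊢
            simp only [addRightEmbedding_apply]
            omega
          · linarith [hω (T.symm^[i] ((P (n + 1)).top x)) (p k)]
  rw [Finset.sum_sub_distrib, Finset.sum_const, Finset.card_range, nsmul_eq_mul] at hsum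
  have hH := height_pos (Q := P (n + 1)) l
  have hup : (P (n + 1)).towerAverage g x ≤ g (p k) + ω - ω / L := by
    rw [towerAverage, ← hl, div_le_iff₀ hH]
    have h1 : ((P (n + 1)).h l : ℝ) * (ω / L) ≤ (P n).h k * ω := by
      rw [mul_div_assoc', div_le_iff₀ hL0]
      nlinarith [mul_le_mul_of_nonneg_right (hL n l k) hω0]
    linarith
  have : (1 - 1 / L) * ω = ω - ω / L := by ring
  linarith

end Average

/-! ### The phase of an eigenfunction -/

section MeasurableEigenfunction

variable {X : Type*} [TopologicalSpace X] {T : X ≃ₜ X} {P : ℕ → CKRPartition T} {α : ℝ} {L : ℝ}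

/-- A representative modulo `ℤ`, of least absolute value, of `α` times the difference of the
entrance times into `B(n+1)` and `B(n)`. -/
noncomputable def phaseStep (P : ℕ → CKRPartition T) (α : ℝ) (n : ℕ) (x : X) : ℝ :=
  α * ((P (n + 1)).rank x - (P n).rank x) - round (α * ((P (n + 1)).rank x - (P n).rank x : ℝ))

/-- A real lift of `α r_n` modulo `ℤ`, where `r_n` is the entrance time into `B(n)`. -/
noncomputable def phase (P : ℕ → CKRPartition T) (α : ℝ) (n : ℕ) (x : X) : ℝ :=
  ∑ i ∈ Finset.range n, phaseStep P α i x

/-- The phase of level `n` minus its mean over the tower of level `n`. These differences of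
successive levels are orthogonal in `L²`. -/
noncomputable def centeredPhase (P : ℕ → CKRPartition T) (α : ℝ) (n : ℕ) (x : X) : ℝ :=
  phase P α n x - (P n).towerAverage (phase P α n) x

theorem IsNestedSeq.constOnAtoms_phaseStep (hP : IsNestedSeq P) (α : ℝ) (n : ℕ) :
    (P (n + 1)).ConstOnAtoms (phaseStep P α n) := fun x y ht hr => by
  rw [phaseStep, phaseStep, hr, (hP.same_atom n.le_succ ht hr).2]

theorem IsNestedSeq.constAlongTowers_phaseStep (hP : IsNestedSeq P) (α : ℝ) (n : ℕ) :
    (P n).ConstAlongTowers (phaseStep P α n) := fun x hx => by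
  have h1 : ((P (n + 1)).rank (T x) - (P n).rank (T x) : ℝ) =
      (P (n + 1)).rank x - (P n).rank x := by
    rw [← (tower_rank_apply hx).2, ← (tower_rank_apply (hP.not_mem_roof n.le_succ hx)).2]
    push_cast
    ring
  rw [phaseStep, phaseStep, h1]

theorem IsNestedSeq.constOnAtoms_phase (hP : IsNestedSeq P) (α : ℝ) (n : ℕ) :
    (P n).ConstOnAtoms (phase P α n) := fun x y ht hr =>
  Finset.sum_congr rfl fun i hi => by
    have hi' : i + 1 ≤ n := Finset.mem_range.1 hi
    exact hP.constOnAtoms_of_le hi' (hP.constOnAtoms_phaseStep α i) x y ht hr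

theorem IsNestedSeq.constOnAtoms_centeredPhase (hP : IsNestedSeq P) (α : ℝ) (n : ℕ) :
    (P n).ConstOnAtoms (centeredPhase P α n) := fun x y ht hr => by
  rw [centeredPhase, centeredPhase, hP.constOnAtoms_phase α n x y ht hr,
    (hP.constOnAtoms_phase α n).towerAverage_eq ht]

theorem IsNestedSeq.unitExp_phase (hP : IsNestedSeq P) (α : ℝ) (n : ℕ) (x : X) :
    unitExp (phase P α n x) = unitExp (α * (P n).rank x) := by
  induction n with
  | zero => simp [phase, hP.rank_zero]
  | succ n ih =>
    rw [phase, Finset.sum_range_succ, unitExp_add]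
    rw [phase] at ih
    rw [ih, phaseStep, unitExp_sub_int, ← unitExp_add]
    ring_nf

theorem IsNestedSeq.unitExp_centeredPhase_apply (hP : IsNestedSeq P) (α : ℝ) (n : ℕ) {x : X}
    (hx : x ∉ (P n).roof) :
    unitExp (-centeredPhase P α n (T x)) = unitExp α * unitExp (-centeredPhase P α n x) := by
  have h1 : ∀ y, unitExp (-centeredPhase P α n y) =
      unitExp ((P n).towerAverage (phase P α n) y) * unitExp (-(α * (P n).rank y)) := by
    intro y
    have h2 : unitExp (-phase P α n y) = unitExp (-(α * (P n).rank y)) := by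
      refine mul_left_cancel₀ (unitExp_ne_zero (phase P α n y)) ?_
      conv_rhs => rw [hP.unitExp_phase]
      rw [← unitExp_add, ← unitExp_add, add_neg_cancel, add_neg_cancel]
    rw [← h2, ← unitExp_add, centeredPhase]
    ring_nf
  rw [h1, h1, constAlongTowers_towerAverage _ _ _ hx, ← (tower_rank_apply hx).2, ← unitExp_add,
    ← unitExp_add, ← unitExp_add]
  push_cast
  ring_nf

/-- A bound for the oscillation of the means of the phase over the towers of level `n`. -/
noncomputable def oscillationBound (P : ℕ → CKRPartition T) (α L : ℝ) : ℕ → ℝ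
  | 0 => 0
  | n + 1 => (1 - 1 / L) * oscillationBound P α L n + 2 * (L * vecDistInt (α • heightVector P n))

theorem IsNestedSeq.abs_phaseStep_le (hP : IsNestedSeq P) (hL : HeightRatioLE P L)
    (α : ℝ) (n : ℕ) (x : X) :
    |phaseStep P α n x| ≤ L * vecDistInt (α • heightVector P n) :=
  hP.distInt_rank_sub_le hL α n x

end MeasurableEigenfunction

end CKRPartition

/-! ### Measurable eigenvalues: sufficiency -/

namespace CKRPartition

section PhaseIncrements

variable {X : Type*} [TopologicalSpace X] {T : X ≃ₜ X} {P : ℕ → CKRPartition T} {L : ℝ}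

theorem phase_succ (α : ℝ) (n : ℕ) :
    phase P α (n + 1) = fun x => phaseStep P α n x + phase P α n x :=
  funext fun x => by rw [phase, Finset.sum_range_succ, add_comm, phase]

theorem IsNestedSeq.towerAverage_phase_succ (hP : IsNestedSeq P) (α : ℝ) (n : ℕ) (x : X) :
    (P (n + 1)).towerAverage (phase P α (n + 1)) x =
      (P (n + 1)).towerAverage (phaseStep P α n) x +
        (P (n + 1)).towerAverage ((P n).towerAverage (phase P α n)) x := by
  rw [phase_succ, towerAverage_add, hP.towerAverage_towerAverage]

/-- By induction on the level, the means of the phase over the towers of level `n` oscillate by at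
most `oscillationBound P α L n`. -/
theorem IsNestedSeq.towerAverage_phase_sub_le (hP : IsNestedSeq P) (hL : HeightRatioLE P L)
    (α : ℝ) (n : ℕ) : ∀ x y : X, (P n).towerAverage (phase P α n) x -
      (P n).towerAverage (phase P α n) y ≤ oscillationBound P α L n := by
  induction n with
  | zero =>
    intro x y
    have : ∀ z : X, (P 0).towerAverage (phase P α 0) z = 0 := fun z => by
      simp [towerAverage, phase]
    simp [this, oscillationBound]
  | succ n ih =>
    intro x y
    have h1 := fun z => abs_le.1 (hP.abs_phaseStep_le hL α n z)
    have h2 := towerAverage_le (Q := P (n + 1)) (fun z => (h1 z).2) x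
    have h3 := le_towerAverage (Q := P (n + 1)) (fun z => (h1 z).1) y
    have h4 := hP.towerAverage_sub_le hL
      (fun z w h => (hP.constOnAtoms_phase α n).towerAverage_eq h) ih x y
    rw [hP.towerAverage_phase_succ, hP.towerAverage_phase_succ, oscillationBound]
    linarith

theorem IsNestedSeq.abs_centeredPhase_sub_le (hP : IsNestedSeq P) (hL : HeightRatioLE P L)
    (α : ℝ) (n : ℕ) (x : X) : |centeredPhase P α (n + 1) x - centeredPhase P α n x| ≤
      2 * (L * vecDistInt (α • heightVector P n)) + oscillationBound P α L n := by
  have h1 := fun z => abs_le.1 (hP.abs_phaseStep_le hL α n z)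
  have h2 := towerAverage_le (Q := P (n + 1)) (fun z => (h1 z).2) x
  have h3 := le_towerAverage (Q := P (n + 1)) (fun z => (h1 z).1) x
  have hosc := hP.towerAverage_phase_sub_le hL α n
  have h4 := towerAverage_le (Q := P (n + 1)) (g := (P n).towerAverage (phase P α n))
    (M := (P n).towerAverage (phase P α n) x + oscillationBound P α L n)
    (fun z => by linarith [hosc z x]) x
  have h5 := le_towerAverage (Q := P (n + 1)) (g := (P n).towerAverage (phase P α n))
    (M := (P n).towerAverage (phase P α n) x - oscillationBound P α L n)
    (fun z => by linarith [hosc x z]) x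
  rw [centeredPhase, centeredPhase, hP.towerAverage_phase_succ, phase_succ, abs_le]
  constructor <;> linarith [(h1 x).1, (h1 x).2]

theorem IsNestedSeq.constAlongTowers_centeredPhase_sub (hP : IsNestedSeq P) (α : ℝ) (n : ℕ) :
    (P n).ConstAlongTowers fun x => centeredPhase P α (n + 1) x - centeredPhase P α n x :=
  fun x hx => by
    simp only [centeredPhase, phase_succ, hP.constAlongTowers_phaseStep α n x hx,
      constAlongTowers_towerAverage (P n) _ x hx,
      hP.constAlongTowers_of_le n.le_succ (constAlongTowers_towerAverage (P (n + 1)) _) x hx]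
    ring

theorem IsNestedSeq.constOnAtoms_centeredPhase_sub (hP : IsNestedSeq P) (α : ℝ) {n m k : ℕ}
    (hn : n ≤ k) (hm : m ≤ k) :
    (P k).ConstOnAtoms fun x => centeredPhase P α m x - centeredPhase P α n x :=
  fun x y ht hr => by
    simp only [hP.constOnAtoms_of_le hn (hP.constOnAtoms_centeredPhase α n) x y ht hr,
      hP.constOnAtoms_of_le hm (hP.constOnAtoms_centeredPhase α m) x y ht hr]

theorem IsNestedSeq.summable_increment_sq (hP : IsNestedSeq P) (hL : HeightRatioLE P L) {α : ℝ}
    (h : Summable fun n => vecDistInt (α • heightVector P n) ^ 2) :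
    Summable fun n => (2 * (L * vecDistInt (α • heightVector P n)) +
      oscillationBound P α L n) ^ 2 := by
  have hL1 := hP.one_le_const hL
  have hL0 : 0 < L := by linarith
  have h1 : Summable fun n => (2 * (L * vecDistInt (α • heightVector P n))) ^ 2 :=
    (h.mul_left ((2 * L) ^ 2)).congr fun n => by ring
  have h2 : Summable fun n => oscillationBound P α L n ^ 2 :=
    summable_sq_of_contraction (ρ := 1 - 1 / L) (sub_nonneg.2 ((div_le_one hL0).2 hL1))
      (sub_lt_self _ (by positivity)) (fun n => rfl) h1
  refine Summable.of_nonneg_of_le (fun n => sq_nonneg _) (fun n => ?_)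
    ((h1.add h2).mul_left 2)
  nlinarith [sq_nonneg (2 * (L * vecDistInt (α • heightVector P n)) - oscillationBound P α L n)]

end PhaseIncrements

variable {X : Type*} [TopologicalSpace X] [CompactSpace X] [MeasurableSpace X] [BorelSpace X]
  {T : X ≃ₜ X} {P : ℕ → CKRPartition T} {Q : CKRPartition T} {μ : Measure X}
  [IsProbabilityMeasure μ] {L : ℝ}

/-- A function minus its average along the towers is orthogonal to the functions that are constant
along the towers. -/
theorem ConstOnAtoms.integral_sub_towerAverage_mul (hμ : MeasurePreserving T μ μ) {g K : X → ℝ}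
    (hg : Q.ConstOnAtoms g) (hK : Q.ConstAlongTowers K) (hKi : Integrable K μ) :
    ∫ x, (g x - Q.towerAverage g x) * K x ∂μ = 0 := by
  have hD : Q.ConstOnAtoms fun x => g x - Q.towerAverage g x := fun x y ht hr => by
    simp only [hg x y ht hr, hg.towerAverage_eq ht]
  have hDK : Integrable (fun x => (g x - Q.towerAverage g x) * K x) μ := by
    simpa only [mul_comm] using hD.integrable_mul hKi
  rw [integral_eq_sum_floors (Q := Q) hDK]
  refine Finset.sum_eq_zero fun k _ => ?_
  obtain ⟨x, hx⟩ := Q.nonempty k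
  have h1 : ∀ i ∈ Finset.range (Q.h k),
      ∫ y in T^[i] ⁻¹' Q.B k, (g y - Q.towerAverage g y) * K y ∂μ =
        (g (T.symm^[i] x) - Q.towerAverage g (T.symm^[i] x)) * ∫ y in Q.B k, K y ∂μ := by
    intro i hi
    rw [Finset.mem_range] at hi
    rw [← (hμ.iterate i).setIntegral_preimage_emb (measurableEmbedding_iterate T i) K (Q.B k),
      ← integral_const_mul]
    refine setIntegral_congr_fun (measurableSet_floor k i) fun y hy => ?_
    have h2 : T^[i] y = Q.top y := by rw [top, (tower_rank_eq hi hy).2]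
    simp only [h2, hK.apply_top, hD.eq_of_mem_floor hi hx hy]
  rw [Finset.sum_congr rfl h1, ← Finset.sum_mul, Finset.sum_sub_distrib, sum_towerAverage hx,
    sub_self, zero_mul]

theorem IsNestedSeq.integral_centeredPhase_mul_sub (hP : IsNestedSeq P)
    (hμ : MeasurePreserving T μ μ) (α : ℝ) {n m : ℕ} (h : n ≤ m) :
    ∫ x, centeredPhase P α n x * (centeredPhase P α (m + 1) x - centeredPhase P α m x) ∂μ = 0 :=
  (hP.constOnAtoms_phase α n).integral_sub_towerAverage_mul hμ
    (hP.constAlongTowers_of_le h (hP.constAlongTowers_centeredPhase_sub α m))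
    (hP.constOnAtoms_centeredPhase_sub α m.le_succ le_rfl).integrable

theorem IsNestedSeq.integral_centeredPhase_sub_sq_le (hP : IsNestedSeq P)
    (hL : HeightRatioLE P L) (hμ : MeasurePreserving T μ μ) (α : ℝ) {n m : ℕ} (h : n ≤ m) :
    ∫ x, (centeredPhase P α m x - centeredPhase P α n x) ^ 2 ∂μ ≤
      ∑ i ∈ Finset.Ico n m, (2 * (L * vecDistInt (α • heightVector P i)) +
        oscillationBound P α L i) ^ 2 := by
  induction m, h using Nat.le_induction with
  | base => simp
  | succ m h ih =>
    rw [Finset.sum_Ico_succ_top h]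
    set D := centeredPhase P α with hD
    have hint : ∀ F : X → ℝ, (P (m + 1)).ConstOnAtoms F → Integrable F μ := fun F hF =>
      hF.integrable
    have hcm := hP.constOnAtoms_of_le m.le_succ (hP.constOnAtoms_centeredPhase α m)
    have hcn := hP.constOnAtoms_of_le (show n ≤ m + 1 by omega)
      (hP.constOnAtoms_centeredPhase α n)
    have hcs := hP.constOnAtoms_centeredPhase α (m + 1)
    -- the cross terms integrate to zero
    have h1 : ∀ x, (D (m + 1) x - D n x) ^ 2 = (D m x - D n x) ^ 2 +
        (2 * (D m x * (D (m + 1) x - D m x)) - 2 * (D n x * (D (m + 1) x - D m x))) +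
          (D (m + 1) x - D m x) ^ 2 := fun x => by ring
    have i1 : Integrable (fun x => (D m x - D n x) ^ 2) μ := hint _ fun x y ht hr => by
      simp only [hD, hcm x y ht hr, hcn x y ht hr]
    have i2 : Integrable (fun x => 2 * (D m x * (D (m + 1) x - D m x))) μ :=
      hint _ fun x y ht hr => by simp only [hD, hcm x y ht hr, hcs x y ht hr]
    have i3 : Integrable (fun x => 2 * (D n x * (D (m + 1) x - D m x))) μ :=
      hint _ fun x y ht hr => by
        simp only [hD, hcm x y ht hr, hcn x y ht hr, hcs x y ht hr]
    have i4 : Integrable (fun x => (D (m + 1) x - D m x) ^ 2) μ :=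
      hint _ fun x y ht hr => by simp only [hD, hcm x y ht hr, hcs x y ht hr]
    have i5 : Integrable (fun x => 2 * (D m x * (D (m + 1) x - D m x)) -
        2 * (D n x * (D (m + 1) x - D m x))) μ := i2.sub i3
    have i6 : Integrable (fun x => (D m x - D n x) ^ 2 + (2 * (D m x * (D (m + 1) x - D m x)) -
        2 * (D n x * (D (m + 1) x - D m x)))) μ := i1.add i5
    simp only [h1]
    rw [integral_add i6 i4, integral_add i1 i5, integral_sub i2 i3,
      integral_const_mul, integral_const_mul, hP.integral_centeredPhase_mul_sub hμ α le_rfl,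
      hP.integral_centeredPhase_mul_sub hμ α h, mul_zero, sub_zero, add_zero]
    refine add_le_add ih ?_
    refine (integral_mono i4 (integrable_const _) fun x =>
      sq_le_sq' ?_ (abs_le.1 (hP.abs_centeredPhase_sub_le hL α m x)).2).trans ?_
    · exact (abs_le.1 (hP.abs_centeredPhase_sub_le hL α m x)).1
    · simp

theorem IsNestedSeq.isMeasurableEigenvalue_of_summable [T1Space X] (hP : IsNestedSeq P)
    (hLR : IsLinearlyRecurrentSeq P) (hT : IsMinimalSystem T)
    (hX : ∀ x : X, ¬ IsOpen ({x} : Set X)) (hμ : MeasurePreserving T μ μ) {α : ℝ}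
    (h : Summable fun n => vecDistInt (α • heightVector P n) ^ 2) :
    IsMeasurableEigenvalue T μ (unitExp α) := by
  obtain ⟨L, hL⟩ := hLR
  have hsum := hP.summable_increment_sq hL h
  have hmem : ∀ n, MemLp (centeredPhase P α n) 2 μ := fun n =>
    (hP.constOnAtoms_centeredPhase α n).continuous.memLp_of_hasCompactSupport
      (HasCompactSupport.of_compactSpace _)
  obtain ⟨G, hG, φ, hφ, hlim⟩ := exists_ae_tendsto_of_cauchy_integral_sq hmem (by
    intro ε hε
    obtain ⟨s, hs⟩ := summable_iff_vanishing_norm.1 hsum ε hε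
    obtain ⟨N, hN⟩ := s.exists_nat_subset_range
    refine ⟨N, fun m hm => (hP.integral_centeredPhase_sub_sq_le hL hμ α hm).trans_lt ?_⟩
    refine (le_abs_self _).trans_lt (hs _ ?_)
    refine Finset.disjoint_left.2 fun i hi his => ?_
    have h1 := Finset.mem_range.1 (hN his)
    have h2 := (Finset.mem_Ico.1 hi).1
    omega)
  obtain ⟨u, hu⟩ := hP.kr3
  have hne : ∀ᵐ x ∂μ, x ≠ u := by
    have := measure_singleton_eq_zero hT hX hμ u
    rwa [ae_iff, show {a | ¬a ≠ u} = {u} by ext; simp]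
  refine ⟨fun x => unitExp (-G x), ?_, ?_, ?_⟩
  · refine MemLp.of_bound ?_ 1 (Eventually.of_forall fun x => (norm_unitExp _).le)
    exact continuous_unitExp.comp_aestronglyMeasurable hG.neg
  · intro h0
    obtain ⟨x, hx⟩ := h0.exists
    exact unitExp_ne_zero _ hx
  · have hev : ∀ y, Tendsto (fun n => centeredPhase P α (φ n) y) atTop (𝓝 (G y)) →
        Tendsto (fun n => unitExp (-centeredPhase P α (φ n) y)) atTop (𝓝 (unitExp (-G y))) :=
      fun y hy => (continuous_unitExp.tendsto _).comp hy.neg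
    filter_upwards [hlim, hμ.quasiMeasurePreserving.ae hlim, hne] with x h1 h2 h3
    have h4 : ∃ n, x ∉ (P n).roof := by
      by_contra! hall
      have : x ∈ ⋂ n, (P n).roof := Set.mem_iInter.2 hall
      rw [hu] at this
      exact h3 this
    obtain ⟨n, hn⟩ := h4
    refine tendsto_nhds_unique (hev _ h2) (((hev x h1).const_mul (unitExp α)).congr' ?_)
    filter_upwards [eventually_ge_atTop n] with m hm
    exact (hP.unitExp_centeredPhase_apply α (φ m)
      (hP.not_mem_roof (hm.trans (hφ.id_le m)) hn)).symm

end CKRPartition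

theorem theorem1 {X : Type*} [TopologicalSpace X] [CompactSpace X]
    [TopologicalSpace.MetrizableSpace X] [MeasurableSpace X] [BorelSpace X]
    (hX : IsCantorSpace X) (T : X ≃ₜ X) (hT : IsMinimalSystem T)
    (P : ℕ → CKRPartition T) (hP : CKRPartition.IsNestedSeq P)
    (hLR : CKRPartition.IsLinearlyRecurrentSeq P) (α : ℝ) :
    (∀ μ : MeasureTheory.Measure X, MeasureTheory.IsProbabilityMeasure μ →
      MeasureTheory.MeasurePreserving T μ μ →
      (IsMeasurableEigenvalue T μ (Complex.exp (2 * Complex.I * Real.pi * α)) ↔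
        Summable fun n : ℕ => vecDistInt (α •
          (CKRPartition.productMatrix P (n + 1)).mulVec (CKRPartition.heightVector P 1)) ^ 2)) ∧
    (IsContinuousEigenvalue T (Complex.exp (2 * Complex.I * Real.pi * α)) ↔
      Summable fun n : ℕ => vecDistInt (α •
        (CKRPartition.productMatrix P (n + 1)).mulVec (CKRPartition.heightVector P 1))) := by
  -- the sums start with `H(2)`; the terms of levels `0` and `1` do not matter
  simp only [hP.productMatrix_mulVec]
  rw [summable_nat_add_iff (f := fun n => vecDistInt (α • CKRPartition.heightVector P n)) 2]
  refine ⟨fun μ _ hμ => ?_, hP.summable_of_isContinuousEigenvalue hT,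
    hP.isContinuousEigenvalue_of_summable hLR hX.2⟩
  rw [summable_nat_add_iff (f := fun n => vecDistInt (α • CKRPartition.heightVector P n) ^ 2) 2]
  exact ⟨hP.summable_of_isMeasurableEigenvalue hLR hμ,
    hP.isMeasurableEigenvalue_of_summable hLR hT hX.2 hμ⟩
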